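/- Let $\bar\epsilon\in(0,1)$. A state $\omega$ is uniform on $[-1,1]$ and a judge observes $s=\omega+\epsilon$, where $\epsilon$ is independent of $\omega$ and uniform on $[-\bar\epsilon,\bar\epsilon]$. One of two speakers is an expert, who sends the message $\omega$; the other is a quack, who does not observe $\omega$ and sends some message $m\in[-1,1]$. A message $m$ is consistent with $s$ if $|m-s|\le\bar\epsilon$. Given a measurable function $\phi:[0,1]\to[0,1]$, the "min" rule generated by $\phi$ is the following: after messages $m_1,m_2$ and signal $s$, the judge selects the sender of the consistent message if exactly one message is consistent; if both are consistent and $|m_1|\neq|m_2|$, she selects the speaker whose message has the smaller absolute value with probability $\phi(\min\{|m_1|,|m_2|\})$ and the other speaker otherwise. (When both messages are consistent and $|m_1|=|m_2|$, or both are inconsistent, which has probability zero, she may use any measurable rule.) Then there is a continuous function $\phi_{\min}:[0,1]\to[0,1]$ such that, under the "min" rule that it generates, the quack is selected with the same probability whichever message $m\in[-1,1]$ he sends, and it is unique: every measurable $\phi:[0,1]\to[0,1]$ whose "min" rule makes the quack indifferent between all messages in $[-1,1]$ coincides with $\phi_{\min}$ on $[0,1)$ (the value at $1$ is used with probability zero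 and is fixed by continuity). Moreover, $\phi_{\min}$ is strictly decreasing on $[0,1]$ and $\phi_{\min}(0)<1/2$; if $\bar\epsilon\le 1/2$, then $\phi_{\min}(0)=1/2-\bar\epsilon/6$. -/

import Mathlib

open MeasureTheory ProbabilityTheory Set

noncomputable section

/-- The prior law of the state `ω`: uniform on `[-1, 1]`. -/
def stateLaw : Measure ℝ := cond volume (Icc (-1 : ℝ) 1)

/-- The law of the noise in the judge's signal: uniform on `[-ε, ε]`. -/
def noiseLaw (ε : ℝ) : Measure ℝ := cond volume (Icc (-ε) ε)

/-- Message `m` is consistent with the judge's signal `s`. -/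
def Consistent (ε m s : ℝ) : Prop := |m - s| ≤ ε

/-- A selection rule of the judge: `σ m₁ m₂ s` is the probability that speaker 1 is selected
(speaker 2 being selected with the complementary probability) when the speakers send messages
`m₁`, `m₂` and the judge's signal is `s`. It is jointly measurable with values in `[0, 1]`. -/
def IsSelectionRule (σ : ℝ → ℝ → ℝ → ℝ) : Prop :=
  Measurable (fun p : ℝ × ℝ × ℝ => σ p.1 p.2.1 p.2.2) ∧
    ∀ m₁ m₂ s, σ m₁ m₂ s ∈ Icc (0 : ℝ) 1

/-- A candidate "min" function: `φ x` is the probability of selecting the more moderate speaker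
when that speaker's message has absolute value `x ∈ [0, 1]`. -/
def IsMinFunction (φ : ℝ → ℝ) : Prop :=
  Measurable φ ∧ ∀ x ∈ Icc (0 : ℝ) 1, φ x ∈ Icc (0 : ℝ) 1

open Classical in
/-- The selection rule generated by `φ`. If exactly one message is consistent with the signal, its
sender is selected. If both are, the speaker whose message has the smaller absolute value is
selected with probability `φ (min |m₁| |m₂|)`. In the remaining cases (both messages consistent
with `|m₁| = |m₂|`, or both inconsistent) the judge follows an arbitrary rule `τ`. -/
def minRule (ε : ℝ) (φ : ℝ → ℝ) (τ : ℝ → ℝ → ℝ → ℝ) (m₁ m₂ s : ℝ) : ℝ :=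
  if Consistent ε m₁ s ∧ ¬ Consistent ε m₂ s then 1
  else if ¬ Consistent ε m₁ s ∧ Consistent ε m₂ s then 0
  else if Consistent ε m₁ s ∧ Consistent ε m₂ s ∧ |m₁| < |m₂| then φ (min |m₁| |m₂|)
  else if Consistent ε m₁ s ∧ Consistent ε m₂ s ∧ |m₂| < |m₁| then 1 - φ (min |m₁| |m₂|)
  else τ m₁ m₂ s

/-- Probability that the quack is selected when he is speaker 1 and sends `m`, while speaker 2 is
the expert, who sends the true state `ω`. The state `p.1` and the noise `p.2` are independent and
the judge's signal is `p.1 + p.2`. -/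
def quackPayoffAsOne (ε : ℝ) (σ : ℝ → ℝ → ℝ → ℝ) (m : ℝ) : ℝ :=
  ∫ p, σ m p.1 (p.1 + p.2) ∂(stateLaw.prod (noiseLaw ε))

/-- Probability that the quack is selected when he is speaker 2 and sends `m`, while speaker 1 is
the expert, who sends the true state. -/
def quackPayoffAsTwo (ε : ℝ) (σ : ℝ → ℝ → ℝ → ℝ) (m : ℝ) : ℝ :=
  ∫ p, (1 - σ p.1 m (p.1 + p.2)) ∂(stateLaw.prod (noiseLaw ε))

/-- Facing a truthful expert and the selection rule `σ`, the quack is indifferent between all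
messages in `[-1, 1]`, whichever of the two speakers he is. -/
def QuackIndifferent (ε : ℝ) (σ : ℝ → ℝ → ℝ → ℝ) : Prop :=
  ∀ m ∈ Icc (-1 : ℝ) 1, ∀ m' ∈ Icc (-1 : ℝ) 1,
    quackPayoffAsOne ε σ m = quackPayoffAsOne ε σ m' ∧
      quackPayoffAsTwo ε σ m = quackPayoffAsTwo ε σ m'

end

/-! Put `δ = 2 * ε`. Given quack message `m` and state `ω`, the noise values for which `m` is also
consistent fill an interval of length `tent δ (m - ω)`, and the expert is always consistent. Folding
`ω` onto `[0, 1]` shows that the payoff is `1 / (4 * ε)` times `payoffCurve δ φ |m|`, so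
indifference says that this curve is a constant `c`. This is a linear Volterra equation for `φ`
whose leading coefficient `upperMass` vanishes only at `m = 1`.

The constant is forced: when the curve is integrated over `[0, 1]`, symmetry of `foldKernel` cancels
all terms in `φ` and leaves `c = payoffLevel δ`. Existence follows from a substitution that sends
`1` to infinity and makes the Volterra kernel bounded (`exists_isProfile`); uniqueness from Picard
iteration on each `[0, b]` with `b < 1` (`eqOn_of_payoffCurve_eq`). At `m = 0` the equation reads `φ
0 * (2 * tentInt δ 1) = payoffLevel δ`, which gives `φ 0 < 1 / 2` and the closed form.

Integrating only up to `b` yields `mass_identity`, which expresses `φ b` through the values of `φ`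
below `b` with nonnegative weights; hence `φ > 0`. For monotonicity, `φ` is differentiated and the
sign of `profileSlope` is settled in three regions: near `1` by `mass_identity`, below `1 - δ` by a
first-failure argument, and, when `1 - δ ≤ δ / 2`, on `[0, δ / 2]` by a last-failure argument that
rests on the bound `φ < 1 / 2`. A positive decreasing function has a limit at `1`, which supplies
the remaining value. -/

/-- The tent function of half-width `δ`. -/
def tent (δ y : ℝ) : ℝ := max 0 (δ - |y|)

/-- The primitive of the tent function that vanishes at `0`. -/
noncomputable def tentInt (δ y : ℝ) : ℝ := ∫ x in (0 : ℝ)..y, tent δ x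

/-- The tent kernel folded onto the half line. -/
def foldKernel (δ x m : ℝ) : ℝ := tent δ (m - x) + tent δ (m + x)

/-- The mass of `foldKernel δ m` on `[m, 1]`. -/
noncomputable def upperMass (δ m : ℝ) : ℝ :=
  tentInt δ (1 - m) + tentInt δ (1 + m) - tentInt δ (2 * m)

/-- The common payoff level, up to normalization. -/
noncomputable def payoffLevel (δ : ℝ) : ℝ := δ ^ 2 / 2 - δ ^ 3 / 12

/-! ### The tent kernel, its primitive and its masses. -/

section Kernel

variable {δ : ℝ}

lemma tent_nonneg (δ y : ℝ) : 0 ≤ tent δ y := le_max_left _ _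

lemma tent_neg (δ y : ℝ) : tent δ (-y) = tent δ y := by simp [tent]

lemma tent_sub_comm (δ x y : ℝ) : tent δ (x - y) = tent δ (y - x) := by
  rw [← tent_neg, neg_sub]

@[fun_prop]
lemma continuous_tent (δ : ℝ) : Continuous (tent δ) := by unfold tent; fun_prop

lemma tent_of_mem {y : ℝ} (h0 : 0 ≤ y) (h1 : y ≤ δ) : tent δ y = δ - y := by
  rw [tent, abs_of_nonneg h0, max_eq_right (by linarith)]

lemma tent_of_ge {y : ℝ} (h0 : 0 ≤ y) (h : δ ≤ y) : tent δ y = 0 := by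
  rw [tent, abs_of_nonneg h0, max_eq_left (by linarith)]

lemma tent_zero (hδ : 0 < δ) : tent δ 0 = δ := by
  rw [tent_of_mem le_rfl hδ.le, sub_zero]

lemma tent_anti {x y : ℝ} (h0 : 0 ≤ x) (h : x ≤ y) : tent δ y ≤ tent δ x := by
  rw [tent, tent, abs_of_nonneg h0, abs_of_nonneg (h0.trans h)]
  exact max_le_max le_rfl (by linarith)

lemma tent_le (hδ : 0 < δ) (y : ℝ) : tent δ y ≤ δ :=
  max_le hδ.le (by linarith [abs_nonneg y])

lemma tent_lt {x y : ℝ} (h0 : 0 ≤ x) (h : x < y) (hx : x < δ) : tent δ y < tent δ x := by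
  rw [tent_of_mem h0 hx.le, tent, abs_of_nonneg (h0.trans h.le)]
  exact max_lt (by linarith) (by linarith)

lemma tent_sub_le {x y : ℝ} (h0 : 0 ≤ x) (h : x ≤ y) : tent δ x - tent δ y ≤ y - x := by
  rw [tent, tent, abs_of_nonneg h0, abs_of_nonneg (h0.trans h)]
  rcases max_cases 0 (δ - x) with h1 | h1 <;> rcases max_cases 0 (δ - y) with h2 | h2 <;> linarith

lemma tentInt_zero (δ : ℝ) : tentInt δ 0 = 0 := by simp [tentInt]

lemma hasDerivAt_tentInt (δ y : ℝ) : HasDerivAt (tentInt δ) (tent δ y) y :=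
  intervalIntegral.integral_hasDerivAt_right ((continuous_tent δ).intervalIntegrable _ _)
    (continuous_tent δ).aestronglyMeasurable.stronglyMeasurableAtFilter
    (continuous_tent δ).continuousAt

@[fun_prop]
lemma continuous_tentInt (δ : ℝ) : Continuous (tentInt δ) :=
  continuous_iff_continuousAt.2 fun y => (hasDerivAt_tentInt δ y).continuousAt

lemma tentInt_sub (δ a b : ℝ) : tentInt δ b - tentInt δ a = ∫ x in a..b, tent δ x :=
  intervalIntegral.integral_interval_sub_left ((continuous_tent δ).intervalIntegrable _ _)
    ((continuous_tent δ).intervalIntegrable _ _)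

lemma tentInt_mono {a b : ℝ} (h : a ≤ b) : tentInt δ a ≤ tentInt δ b := by
  rw [← sub_nonneg, tentInt_sub]
  exact intervalIntegral.integral_nonneg h fun x _ => tent_nonneg δ x

lemma tentInt_of_mem {y : ℝ} (h0 : 0 ≤ y) (h1 : y ≤ δ) : tentInt δ y = δ * y - y ^ 2 / 2 := by
  have : tentInt δ y = ∫ x in (0 : ℝ)..y, (δ - x) := by
    refine intervalIntegral.integral_congr fun x hx => ?_
    rw [uIcc_of_le h0] at hx
    exact tent_of_mem hx.1 (hx.2.trans h1)
  rw [this, intervalIntegral.integral_sub (by simp) (by simp)]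
  simp; ring

lemma tentInt_of_ge (hδ : 0 < δ) {y : ℝ} (h : δ ≤ y) : tentInt δ y = δ ^ 2 / 2 := by
  have h1 : ∫ x in δ..y, tent δ x = ∫ x in δ..y, (0 : ℝ) := by
    refine intervalIntegral.integral_congr fun x hx => ?_
    rw [uIcc_of_le h] at hx
    exact tent_of_ge (hδ.le.trans hx.1) hx.1
  have h2 := tentInt_sub δ δ y
  rw [h1, intervalIntegral.integral_zero, tentInt_of_mem hδ.le le_rfl] at h2
  nlinarith

lemma tentInt_le (hδ : 0 < δ) (y : ℝ) : tentInt δ y ≤ δ ^ 2 / 2 :=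
  (tentInt_mono (le_max_left y δ)).trans (tentInt_of_ge hδ (le_max_right y δ)).le

lemma integral_tent_sub (δ a b m : ℝ) :
    ∫ x in a..b, tent δ (x - m) = tentInt δ (b - m) - tentInt δ (a - m) := by
  rw [tentInt_sub, intervalIntegral.integral_comp_sub_right (fun x => tent δ x)]

lemma foldKernel_comm (δ x m : ℝ) : foldKernel δ x m = foldKernel δ m x := by
  rw [foldKernel, foldKernel, tent_sub_comm, add_comm m x]

lemma foldKernel_nonneg (δ x m : ℝ) : 0 ≤ foldKernel δ x m :=
  add_nonneg (tent_nonneg _ _) (tent_nonneg _ _)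

lemma foldKernel_le (hδ : 0 < δ) (x m : ℝ) : foldKernel δ x m ≤ 2 * δ := by
  rw [foldKernel]; linarith [tent_le hδ (m - x), tent_le hδ (m + x)]

@[fun_prop]
lemma continuous_foldKernel (δ : ℝ) : Continuous fun p : ℝ × ℝ => foldKernel δ p.1 p.2 := by
  unfold foldKernel; fun_prop

lemma continuous_foldKernel_left (δ m : ℝ) : Continuous fun x => foldKernel δ x m :=
  (continuous_foldKernel δ).comp (by fun_prop : Continuous fun x : ℝ => (x, m))

lemma continuous_foldKernel_right (δ x : ℝ) : Continuous fun m => foldKernel δ x m :=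
  (continuous_foldKernel δ).comp (by fun_prop : Continuous fun m : ℝ => (x, m))

lemma integral_foldKernel (δ a b m : ℝ) :
    ∫ x in a..b, foldKernel δ m x =
      tentInt δ (b - m) - tentInt δ (a - m) + (tentInt δ (b + m) - tentInt δ (a + m)) := by
  have hc (c : ℝ) : IntervalIntegrable (fun x => tent δ (x - c)) volume a b :=
    ((continuous_tent δ).comp (by fun_prop)).intervalIntegrable _ _
  have h := integral_tent_sub δ a b (-m)
  simp only [sub_neg_eq_add] at h
  simp only [foldKernel]
  rw [intervalIntegral.integral_add (hc m) (by simpa using hc (-m)), integral_tent_sub, h]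

lemma integral_foldKernel_upper (δ m : ℝ) :
    ∫ x in m..1, foldKernel δ m x = upperMass δ m := by
  rw [integral_foldKernel, upperMass, sub_self, tentInt_zero, two_mul]; ring

lemma integral_foldKernel_lower (δ m : ℝ) :
    ∫ x in (0 : ℝ)..m, foldKernel δ x m = tentInt δ (2 * m) := by
  simp_rw [fun x => foldKernel_comm δ x m]
  rw [integral_foldKernel, sub_self, tentInt_zero, two_mul, zero_add, zero_sub m]
  have : tentInt δ (-m) = - tentInt δ m := by
    have := intervalIntegral.integral_comp_neg (fun x => tent δ x) (a := 0) (b := m)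
    simp only [tent_neg, neg_zero] at this
    rw [tentInt, tentInt, this, intervalIntegral.integral_symm]
  rw [this]; ring

@[fun_prop]
lemma continuous_upperMass (δ : ℝ) : Continuous (upperMass δ) := by
  unfold upperMass; fun_prop

/-- Since `2 * m ≤ 1 + m`, the term `tentInt δ (1 - m)` alone suffices. The linear rate in `1 - m`
measures the degeneracy of the equation at `1`, and both existence and uniqueness depend on it. -/
lemma upperMass_ge (hδ : 0 < δ) (hδ2 : δ < 2) {m : ℝ} (h0 : 0 ≤ m) (h1 : m ≤ 1) :
    δ ^ 2 / 4 * (1 - m) ≤ upperMass δ m := by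
  have h2 : tentInt δ (2 * m) ≤ tentInt δ (1 + m) := tentInt_mono (by linarith)
  rw [upperMass]
  rcases le_total (1 - m) δ with h | h
  · rw [tentInt_of_mem (by linarith) h]
    have h3 : δ ^ 2 / 4 ≤ δ / 2 := by nlinarith
    nlinarith [mul_le_mul_of_nonneg_right h3 (sub_nonneg.2 h1)]
  · rw [tentInt_of_ge hδ h]; nlinarith [mul_nonneg (sq_nonneg δ) h0]

lemma upperMass_pos (hδ : 0 < δ) (hδ2 : δ < 2) {m : ℝ} (h0 : 0 ≤ m) (h1 : m < 1) :
    0 < upperMass δ m := by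
  have := upperMass_ge hδ hδ2 h0 h1.le
  have : 0 < δ ^ 2 / 4 * (1 - m) := mul_pos (by positivity) (by linarith)
  linarith

lemma integral_tentInt_two_mul (hδ : 0 < δ) (hδ2 : δ < 2) :
    ∫ y in (0 : ℝ)..1, tentInt δ (2 * y) = payoffLevel δ := by
  have hc (a b : ℝ) : IntervalIntegrable (fun y => tentInt δ (2 * y)) volume a b :=
    ((continuous_tentInt δ).comp (by fun_prop)).intervalIntegrable _ _
  rw [← intervalIntegral.integral_add_adjacent_intervals (hc 0 (δ / 2)) (hc (δ / 2) 1)]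
  have h1 : ∫ y in (0 : ℝ)..δ / 2, tentInt δ (2 * y) =
      ∫ y in (0 : ℝ)..δ / 2, ((2 * δ) * y - 2 * y ^ 2) := by
    refine intervalIntegral.integral_congr fun y hy => ?_
    rw [uIcc_of_le (by linarith)] at hy
    simp only [tentInt_of_mem (δ := δ) (y := 2 * y) (by linarith [hy.1]) (by linarith [hy.2])]
    ring
  have h2 : ∫ y in δ / 2..1, tentInt δ (2 * y) = ∫ y in δ / 2..1, δ ^ 2 / 2 := by
    refine intervalIntegral.integral_congr fun y hy => ?_
    rw [uIcc_of_le (by linarith)] at hy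
    exact tentInt_of_ge hδ (by linarith [hy.1])
  have h3 : ∫ y in (0 : ℝ)..δ / 2, ((2 * δ) * y - 2 * y ^ 2) =
      (δ * (δ / 2) ^ 2 - 2 / 3 * (δ / 2) ^ 3) - (δ * 0 ^ 2 - 2 / 3 * 0 ^ 3) := by
    refine intervalIntegral.integral_eq_sub_of_hasDerivAt
      (f := fun y => δ * y ^ 2 - 2 / 3 * y ^ 3) (fun y _ => ?_)
      (Continuous.intervalIntegrable (by fun_prop) _ _)
    refine (((hasDerivAt_pow 2 y).const_mul δ).fun_sub
      ((hasDerivAt_pow 3 y).const_mul (2 / 3))).congr_deriv ?_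
    push_cast
    ring
  rw [h1, h2, h3, intervalIntegral.integral_const, payoffLevel, smul_eq_mul]
  ring

lemma payoffLevel_pos (hδ : 0 < δ) (hδ2 : δ < 2) : 0 < payoffLevel δ := by
  unfold payoffLevel; nlinarith [pow_pos hδ 2, pow_pos hδ 3]

/-- By the equation at `m = 0`, this is the inequality `φ 0 < 1 / 2`. -/
lemma payoffLevel_lt (hδ : 0 < δ) : payoffLevel δ < tentInt δ 1 := by
  unfold payoffLevel
  rcases le_total δ 1 with h | h
  · rw [tentInt_of_ge hδ h]; have := pow_pos hδ 3; linarith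
  · rw [tentInt_of_mem zero_le_one h]
    nlinarith [mul_nonneg (sub_nonneg.2 h) (sq_nonneg (δ - 2)), sq_nonneg (δ - 2)]

end Kernel

/-! ### Existence: Volterra equations and the substitution at infinity. -/

open BoundedContinuousFunction in
/-- A linear Volterra equation of the second kind with bounded continuous data has a solution. -/
lemma exists_volterra_solution {f : ℝ → ℝ} {k : ℝ → ℝ → ℝ} {B M : ℝ} (hf : Continuous f)
    (hfB : ∀ u, |f u| ≤ B) (hk : Continuous fun p : ℝ × ℝ => k p.1 p.2)
    (hkM : ∀ u v, |k u v| ≤ M) :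
    ∃ χ : ℝ → ℝ, Continuous χ ∧ ∀ u, 0 ≤ u → χ u = f u + ∫ v in (0 : ℝ)..u, k u v * χ v := by
  have hM : 0 ≤ M := (abs_nonneg _).trans (hkM 0 0)
  -- With the weight `exp (-lam * u)` the integral operator has norm at most `M / lam`, and this
  -- `lam` makes that at most `1 / 2`.
  set lam : ℝ := 2 * M + 1 with hlam
  have hlam0 : 0 < lam := by positivity
  have hker : ∀ u : ℝ, 0 ≤ u → ∫ v in (0 : ℝ)..u, M * Real.exp (-lam * (u - v)) ≤ 1 / 2 := by
    intro u hu
    have hd : ∀ v ∈ uIcc (0 : ℝ) u, HasDerivAt (fun v => M / lam * Real.exp (-lam * (u - v)))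
        (M * Real.exp (-lam * (u - v))) v := by
      intro v _
      have h1 : HasDerivAt (fun v => -lam * (u - v)) lam v := by
        simpa using ((hasDerivAt_id v).const_sub u).const_mul (-lam)
      refine ((h1.exp).const_mul (M / lam)).congr_deriv ?_
      field_simp
    rw [intervalIntegral.integral_eq_sub_of_hasDerivAt hd
      (Continuous.intervalIntegrable (by fun_prop) _ _)]
    have h2 : M / lam ≤ 1 / 2 := by rw [div_le_div_iff₀ hlam0 two_pos]; linarith
    have h3 : 0 ≤ M / lam * Real.exp (-lam * (u - 0)) := by positivity
    simp only [sub_self, mul_zero, Real.exp_zero, mul_one]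
    linarith
  have hcont : ∀ g : ℝ →ᵇ ℝ, Continuous fun u : ℝ =>
      ∫ v in (0 : ℝ)..max u 0, k (max u 0) v * Real.exp (-lam * (max u 0 - v)) * g v := by
    intro g
    refine intervalIntegral.continuous_parametric_intervalIntegral_of_continuous
      (f := fun u v => k (max u 0) v * Real.exp (-lam * (max u 0 - v)) * g v) ?_ (by fun_prop)
    have h1 : Continuous fun p : ℝ × ℝ => k (max p.1 0) p.2 :=
      hk.comp (by fun_prop : Continuous fun p : ℝ × ℝ => (max p.1 0, p.2))
    have h2 : Continuous fun p : ℝ × ℝ => g p.2 := g.continuous.comp continuous_snd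
    simp only [Function.uncurry_def]
    fun_prop
  have hbound : ∀ (g : ℝ → ℝ) (R : ℝ), Continuous g → (∀ v, |g v| ≤ R) → ∀ u : ℝ, 0 ≤ u →
      |∫ v in (0 : ℝ)..u, k u v * Real.exp (-lam * (u - v)) * g v| ≤ 1 / 2 * R := by
    intro g R hg hR u hu
    have hR0 : 0 ≤ R := (abs_nonneg _).trans (hR 0)
    calc |∫ v in (0 : ℝ)..u, k u v * Real.exp (-lam * (u - v)) * g v|
        ≤ ∫ v in (0 : ℝ)..u, (M * Real.exp (-lam * (u - v))) * R := by
          rw [← Real.norm_eq_abs]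
          refine intervalIntegral.norm_integral_le_of_norm_le hu ?_
            (Continuous.intervalIntegrable (by fun_prop) _ _)
          filter_upwards with v _
          rw [Real.norm_eq_abs, abs_mul, abs_mul, abs_of_pos (Real.exp_pos _)]
          gcongr
          · exact hkM u v
          · exact hR v
      _ = (∫ v in (0 : ℝ)..u, M * Real.exp (-lam * (u - v))) * R := by
          rw [intervalIntegral.integral_mul_const]
      _ ≤ 1 / 2 * R := mul_le_mul_of_nonneg_right (hker u hu) hR0
  -- The unknown is `g u = exp (-lam * u) * χ u`. Replacing `u` by `max u 0` keeps everything
  -- bounded and continuous on the whole line without affecting `u ≥ 0`.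
  let T : (ℝ →ᵇ ℝ) → (ℝ →ᵇ ℝ) := fun g => BoundedContinuousFunction.ofNormedAddCommGroup
    (fun u => Real.exp (-lam * max u 0) * f u +
      ∫ v in (0 : ℝ)..max u 0, k (max u 0) v * Real.exp (-lam * (max u 0 - v)) * g v)
    (((by fun_prop : Continuous fun u => Real.exp (-lam * max u 0) * f u)).add (hcont g))
    (B + 1 / 2 * ‖g‖) (by
      intro u
      refine (norm_add_le _ _).trans (add_le_add ?_ ?_)
      · rw [Real.norm_eq_abs, abs_mul, abs_of_pos (Real.exp_pos _)]
        have h1 : Real.exp (-lam * max u 0) ≤ 1 := by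
          rw [Real.exp_le_one_iff]
          have := mul_nonneg hlam0.le (le_max_right u 0); linarith
        calc _ ≤ 1 * B := mul_le_mul h1 (hfB u) (abs_nonneg _) zero_le_one
          _ = B := one_mul B
      · exact hbound g ‖g‖ g.continuous (fun v => g.norm_coe_le_norm v) _ (le_max_right _ _))
  have hT : ContractingWith (1 / 2 : NNReal) T := by
    refine ⟨by rw [← NNReal.coe_lt_coe]; norm_num, LipschitzWith.of_dist_le_mul fun g g' => ?_⟩
    rw [BoundedContinuousFunction.dist_le (by positivity)]
    intro u
    have hint : ∀ g : ℝ →ᵇ ℝ, IntervalIntegrable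
        (fun v => k (max u 0) v * Real.exp (-lam * (max u 0 - v)) * g v) volume 0 (max u 0) := by
      intro g
      have h1 : Continuous fun v : ℝ => k (max u 0) v :=
        hk.comp (by fun_prop : Continuous fun v : ℝ => (max u 0, v))
      have h2 := g.continuous
      exact Continuous.intervalIntegrable (by fun_prop) _ _
    have h3 := hbound (fun v => g v - g' v) (dist g g') (g.continuous.sub g'.continuous)
      (fun v => by rw [← Real.dist_eq]; exact BoundedContinuousFunction.dist_coe_le_dist v) (max u 0)
      (le_max_right _ _)
    rw [Real.dist_eq]
    have h4 : T g u - T g' u = ∫ v in (0 : ℝ)..max u 0,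
        k (max u 0) v * Real.exp (-lam * (max u 0 - v)) * (g v - g' v) := by
      simp only [T, BoundedContinuousFunction.coe_ofNormedAddCommGroup]
      rw [add_sub_add_left_eq_sub, ← intervalIntegral.integral_sub (hint g) (hint g')]
      refine intervalIntegral.integral_congr fun v _ => ?_
      ring
    rw [h4]
    simpa using h3
  obtain ⟨g, hg⟩ : ∃ g, T g = g := ⟨_, hT.fixedPoint_isFixedPt⟩
  refine ⟨fun u => Real.exp (lam * u) * g u, by have := g.continuous; fun_prop, fun u hu => ?_⟩
  have h5 : g u = Real.exp (-lam * u) * f u +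
      ∫ v in (0 : ℝ)..u, k u v * Real.exp (-lam * (u - v)) * g v := by
    conv_lhs => rw [← hg]
    simp only [T, BoundedContinuousFunction.coe_ofNormedAddCommGroup, max_eq_left hu]
  have h6 : Real.exp (lam * u) * Real.exp (-lam * u) = 1 := by rw [← Real.exp_add]; simp
  simp only
  rw [h5, mul_add, ← mul_assoc, h6, one_mul, ← intervalIntegral.integral_const_mul]
  congr 1
  refine intervalIntegral.integral_congr fun v _ => ?_
  have h7 : Real.exp (lam * v) = Real.exp (lam * u) * Real.exp (-lam * (u - v)) := by
    rw [← Real.exp_add]; congr 1; ring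
  simp only [h7]; ring

/-- The equation satisfied by an even profile `φ` on `(-1, 1)` whose rule makes the quack's payoff
constant on `[0, 1)`. -/
structure IsProfile (δ : ℝ) (φ : ℝ → ℝ) : Prop where
  even : ∀ x, φ (-x) = φ x
  cont : ContinuousOn φ (Ioo (-1) 1)
  eqn : ∀ m ∈ Ico (0 : ℝ) 1, φ m * upperMass δ m =
    payoffLevel δ - tentInt δ (2 * m) + ∫ x in (0 : ℝ)..m, φ x * foldKernel δ x m

/-- Substitute `m = 1 - exp (-u)` and solve for `χ = (1 - m) * φ`. The factor `1 - m` compensates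
the zero of `upperMass` at `1`, so by `upperMass_ge` the weight `w` is at most `4 / δ ^ 2`, and the
new equation has bounded data on `[0, ∞)`. -/
lemma exists_isProfile {δ : ℝ} (hδ : 0 < δ) (hδ2 : δ < 2) : ∃ φ, IsProfile δ φ := by
  let m : ℝ → ℝ := fun u => 1 - Real.exp (-|u|)
  have hm0 : ∀ u, 0 ≤ m u := fun u => by
    simp only [m, sub_nonneg, Real.exp_le_one_iff]; simp
  have hm1 : ∀ u, m u < 1 := fun u => by simp only [m]; linarith [Real.exp_pos (-|u|)]
  have hmc : Continuous m := by fun_prop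
  have hApos : ∀ u, 0 < upperMass δ (m u) := fun u => upperMass_pos hδ hδ2 (hm0 u) (hm1 u)
  let w : ℝ → ℝ := fun u => (1 - m u) / upperMass δ (m u)
  have hwc : Continuous w :=
    (by fun_prop : Continuous fun u => 1 - m u).div (by fun_prop) fun u => (hApos u).ne'
  have hw0 : ∀ u, 0 ≤ w u := fun u => div_nonneg (by linarith [hm1 u]) (hApos u).le
  have hwle : ∀ u, w u ≤ 4 / δ ^ 2 := fun u => by
    rw [div_le_div_iff₀ (hApos u) (by positivity)]
    have := upperMass_ge hδ hδ2 (hm0 u) (hm1 u).le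
    linarith
  have hF : ∀ u, |payoffLevel δ - tentInt δ (2 * m u)| ≤ payoffLevel δ + δ ^ 2 / 2 := by
    intro u
    have h1 := tentInt_le hδ (2 * m u)
    have h2 : 0 ≤ tentInt δ (2 * m u) := by
      rw [← tentInt_zero δ]; exact tentInt_mono (by linarith [hm0 u])
    have h3 := payoffLevel_pos hδ hδ2
    rw [abs_le]; constructor <;> nlinarith
  obtain ⟨χ, hχc, hχ⟩ := exists_volterra_solution
    (f := fun u => w u * (payoffLevel δ - tentInt δ (2 * m u)))
    (k := fun u v => w u * foldKernel δ (m v) (m u)) (B := 4 / δ ^ 2 * (payoffLevel δ + δ ^ 2 / 2))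
    (M := 4 / δ ^ 2 * (2 * δ)) (by fun_prop)
    (fun u => by
      rw [abs_mul, abs_of_nonneg (hw0 u)]
      exact mul_le_mul (hwle u) (hF u) (abs_nonneg _) (by positivity))
    (by
      have h1 : Continuous fun p : ℝ × ℝ => foldKernel δ (m p.2) (m p.1) :=
        (continuous_foldKernel δ).comp (by fun_prop : Continuous fun p : ℝ × ℝ => (m p.2, m p.1))
      fun_prop)
    (fun u v => by
      rw [abs_mul, abs_of_nonneg (hw0 u), abs_of_nonneg (foldKernel_nonneg _ _ _)]
      exact mul_le_mul (hwle u) (foldKernel_le hδ _ _) (foldKernel_nonneg _ _ _) (by positivity))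
  have hφc : ContinuousOn (fun x => χ (-Real.log (1 - |x|)) / (1 - |x|)) (Ioo (-1) 1) := by
    have hne : ∀ x ∈ Ioo (-1 : ℝ) 1, 1 - |x| ≠ 0 := fun x hx => by
      have := abs_lt.2 hx; exact (by linarith : 0 < 1 - |x|).ne'
    refine ContinuousOn.div (hχc.comp_continuousOn ?_) (by fun_prop) hne
    exact (ContinuousOn.log (by fun_prop) hne).neg
  refine ⟨fun x => χ (-Real.log (1 - |x|)) / (1 - |x|), by simp, hφc, fun y hy => ?_⟩
  set u := -Real.log (1 - y) with hu
  have hy1 : 0 < 1 - y := by linarith [hy.2]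
  have hu0 : 0 ≤ u := by
    rw [hu, neg_nonneg]; exact Real.log_nonpos hy1.le (by linarith [hy.1])
  have hmu : m u = y := by
    simp only [m, abs_of_nonneg hu0]; rw [hu, neg_neg, Real.exp_log hy1]; ring
  have hA := hApos u
  rw [hmu] at hA
  have hχu := hχ u hu0
  simp only [abs_of_nonneg hy.1]
  rw [← hu, hχu]
  -- The Jacobian `exp (-v)` equals `1 - m v` and cancels the denominator of `φ`.
  have hsub : ∫ x in (0 : ℝ)..y, χ (-Real.log (1 - |x|)) / (1 - |x|) * foldKernel δ x y =
      ∫ v in (0 : ℝ)..u, foldKernel δ (m v) y * χ v := by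
    have hd : ∀ v ∈ uIcc 0 u, HasDerivAt (fun v => 1 - Real.exp (-v)) (Real.exp (-v)) v := by
      intro v _
      simpa using ((hasDerivAt_neg v).exp).const_sub 1
    have := intervalIntegral.integral_comp_mul_deriv'' (a := 0) (b := u)
      (f := fun v => 1 - Real.exp (-v)) (f' := fun v => Real.exp (-v))
      (g := fun x => χ (-Real.log (1 - |x|)) / (1 - |x|) * foldKernel δ x y)
      (by fun_prop) (fun v hv => (hd v (by
        exact Ioo_subset_Icc_self hv)).hasDerivWithinAt) (by fun_prop) (by
        refine ContinuousOn.mul (hφc.mono ?_) (continuous_foldKernel_left δ y).continuousOn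
        rintro _ ⟨v, hv, rfl⟩
        rw [uIcc_of_le hu0] at hv
        have h1 := Real.exp_pos (-v)
        have h2 : Real.exp (-v) ≤ 1 := by rw [Real.exp_le_one_iff]; linarith [hv.1]
        constructor <;> simp only <;> linarith)
    have h0 : (1 : ℝ) - Real.exp (-0) = 0 := by simp
    have h1 : (1 : ℝ) - Real.exp (-u) = y := by rw [hu, neg_neg, Real.exp_log hy1]; ring
    simp only [h0, h1] at this
    rw [← this]
    refine intervalIntegral.integral_congr fun v hv => ?_
    rw [uIcc_of_le hu0] at hv
    have h2 : Real.exp (-v) ≤ 1 := by rw [Real.exp_le_one_iff]; linarith [hv.1]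
    have h3 := Real.exp_pos (-v)
    simp only [Function.comp, m, abs_of_nonneg hv.1,
      abs_of_nonneg (by linarith : 0 ≤ 1 - Real.exp (-v)), sub_sub_cancel, Real.log_exp, neg_neg]
    field_simp
  rw [hsub]
  simp only [mul_assoc, intervalIntegral.integral_const_mul, hmu, w]
  field_simp

/-! ### Kernel symmetry, the mass identity and positivity. -/

lemma integral_triangle_swap {b M : ℝ} (hb : 0 ≤ b) {φ : ℝ → ℝ}
    (hφ : IntervalIntegrable φ volume 0 b) {K : ℝ → ℝ → ℝ}
    (hK : Continuous fun p : ℝ × ℝ => K p.1 p.2) (hM : ∀ x y, |K x y| ≤ M) :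
    IntervalIntegrable (fun m => ∫ x in (0 : ℝ)..m, φ x * K x m) volume 0 b ∧
      ∫ m in (0 : ℝ)..b, ∫ x in (0 : ℝ)..m, φ x * K x m =
        ∫ x in (0 : ℝ)..b, φ x * ∫ m in x..b, K x m := by
  set μ : Measure ℝ := volume.restrict (Ioc 0 b) with hμ
  have hφ' : Integrable φ μ := (intervalIntegrable_iff_integrableOn_Ioc_of_le hb).1 hφ
  let g : ℝ → ℝ → ℝ := fun m x => {p : ℝ × ℝ | p.2 ≤ p.1}.indicator (fun p => φ p.2 * K p.2 p.1) (m, x)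
  have hg : Integrable (Function.uncurry g) (μ.prod μ) := by
    have h1 : Integrable (fun p : ℝ × ℝ => φ p.2) (μ.prod μ) := hφ'.comp_snd μ
    have h2 : Continuous fun p : ℝ × ℝ => K p.2 p.1 :=
      hK.comp (by fun_prop : Continuous fun p : ℝ × ℝ => (p.2, p.1))
    have h3 : Integrable (fun p : ℝ × ℝ => φ p.2 * K p.2 p.1) (μ.prod μ) :=
      h1.mul_bdd (c := M) h2.aestronglyMeasurable (ae_of_all _ fun p => hM _ _)
    exact h3.indicator (measurableSet_le measurable_snd measurable_fst)
  have hin : ∀ m ∈ Ioc 0 b, ∫ x, g m x ∂μ = ∫ x in (0 : ℝ)..m, φ x * K x m := by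
    intro m hm
    have h1 : (fun x => g m x) = (Iic m).indicator fun x => φ x * K x m := by
      ext x; simp only [g, indicator, mem_ofPred_eq, mem_Iic]
    rw [h1, integral_indicator measurableSet_Iic, hμ, Measure.restrict_restrict measurableSet_Iic,
      intervalIntegral.integral_of_le hm.1.le]
    congr 2
    ext x
    simp only [mem_inter_iff, mem_Iic, mem_Ioc]
    exact ⟨fun h => ⟨h.2.1, h.1⟩, fun h => ⟨h.2, h.1, h.2.trans hm.2⟩⟩
  have hout : ∀ x ∈ Ioc 0 b, ∫ m, g m x ∂μ = φ x * ∫ m in x..b, K x m := by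
    intro x hx
    have h1 : (fun m => g m x) = (Ici x).indicator fun m => φ x * K x m := by
      ext m; simp only [g, indicator, mem_ofPred_eq, mem_Ici]
    rw [h1, integral_indicator measurableSet_Ici, hμ, Measure.restrict_restrict measurableSet_Ici,
      intervalIntegral.integral_of_le hx.2, ← integral_const_mul, ← integral_Icc_eq_integral_Ioc]
    congr 2
    ext m
    simp only [mem_inter_iff, mem_Ici, mem_Ioc, mem_Icc]
    exact ⟨fun h => ⟨h.1, h.2.2⟩, fun h => ⟨h.1, hx.1.trans_le h.1, h.2⟩⟩
  constructor
  · rw [intervalIntegrable_iff_integrableOn_Ioc_of_le hb]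
    exact (integrableOn_congr_fun hin measurableSet_Ioc).1 hg.integral_prod_left
  · rw [intervalIntegral.integral_of_le hb, intervalIntegral.integral_of_le hb,
      ← setIntegral_congr_fun measurableSet_Ioc hin, ← setIntegral_congr_fun measurableSet_Ioc hout]
    exact integral_integral_swap hg

lemma continuous_integral_foldKernel (δ a b : ℝ) :
    Continuous fun m => ∫ x in a..b, foldKernel δ m x := by
  simp_rw [integral_foldKernel]
  fun_prop

lemma abs_foldKernel_le {δ : ℝ} (hδ : 0 < δ) (x m : ℝ) : |foldKernel δ x m| ≤ 2 * δ := by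
  rw [abs_of_nonneg (foldKernel_nonneg _ _ _)]; exact foldKernel_le hδ x m

/-- By Fubini and the symmetry built into the kernel, the interactions inside `[0, b]` cancel,
leaving those between `[0, b]` and `[b, 1]`. At `b = 1` nothing remains, which fixes the payoff
level. Only integrability of `φ` is assumed, so arbitrary min functions are covered. -/
lemma integral_payoff_identity {δ b : ℝ} (hδ : 0 < δ) (hb : 0 ≤ b) {φ : ℝ → ℝ}
    (hφ : IntervalIntegrable φ volume 0 b) :
    ∫ m in (0 : ℝ)..b, (φ m * upperMass δ m - ∫ x in (0 : ℝ)..m, φ x * foldKernel δ x m) =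
      ∫ m in (0 : ℝ)..b, φ m * ∫ x in b..1, foldKernel δ m x := by
  obtain ⟨h1, h2⟩ := integral_triangle_swap hb hφ (continuous_foldKernel δ) (abs_foldKernel_le hδ)
  have h3 : IntervalIntegrable (fun m => φ m * upperMass δ m) volume 0 b :=
    hφ.mul_continuousOn (continuous_upperMass δ).continuousOn
  have h4 : IntervalIntegrable (fun m => φ m * ∫ x in m..b, foldKernel δ m x) volume 0 b := by
    refine hφ.mul_continuousOn (Continuous.continuousOn ?_)
    simp_rw [integral_foldKernel]
    fun_prop
  rw [intervalIntegral.integral_sub h3 h1, h2, ← intervalIntegral.integral_sub h3 h4]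
  refine intervalIntegral.integral_congr fun m _ => ?_
  have hc (u v : ℝ) : IntervalIntegrable (fun x => foldKernel δ m x) volume u v :=
    (continuous_foldKernel_right δ m).intervalIntegrable _ _
  rw [← integral_foldKernel_upper,
    ← intervalIntegral.integral_add_adjacent_intervals (hc m b) (hc b 1)]
  ring

namespace IsProfile

variable {δ : ℝ} {φ : ℝ → ℝ}

lemma intervalIntegrable (h : IsProfile δ φ) {a b : ℝ} (ha : a ∈ Ioo (-1 : ℝ) 1)
    (hb : b ∈ Ioo (-1 : ℝ) 1) : IntervalIntegrable φ volume a b :=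
  (h.cont.mono (ordConnected_Ioo.uIcc_subset ha hb)).intervalIntegrable

/-- Multiply the equation at `b` by `1 - b`, then eliminate `payoffLevel` by means of its integral
formula and the equation integrated over `[0, b]`. The weights multiplying `φ m` are nonnegative
because `foldKernel δ m` decreases on `[b, 1]` for `0 ≤ m ≤ b`. -/
lemma mass_identity (h : IsProfile δ φ) (hδ : 0 < δ) (hδ2 : δ < 2) {b : ℝ} (hb : b ∈ Ico (0 : ℝ) 1) :
    (1 - b) * (φ b * upperMass δ b) = (∫ y in b..1, (tentInt δ (2 * y) - tentInt δ (2 * b))) +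
      ∫ m in (0 : ℝ)..b, φ m * ∫ x in b..1, (foldKernel δ m b - foldKernel δ m x) := by
  have hφ := h.intervalIntegrable (a := 0) (b := b) (by norm_num) ⟨by linarith [hb.1], hb.2⟩
  have hF (u v : ℝ) : IntervalIntegrable (fun y => tentInt δ (2 * y)) volume u v :=
    ((continuous_tentInt δ).comp (by fun_prop)).intervalIntegrable _ _
  have h1 := integral_payoff_identity hδ hb.1 hφ
  have h2 : ∫ m in (0 : ℝ)..b, (φ m * upperMass δ m - ∫ x in (0 : ℝ)..m, φ x * foldKernel δ x m) =
      ∫ m in (0 : ℝ)..b, (payoffLevel δ - tentInt δ (2 * m)) := by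
    refine intervalIntegral.integral_congr fun m hm => ?_
    rw [uIcc_of_le hb.1] at hm
    rw [h.eqn m ⟨hm.1, hm.2.trans_lt hb.2⟩]; ring
  have h3 := intervalIntegral.integral_add_adjacent_intervals (hF 0 b) (hF b 1)
  rw [integral_tentInt_two_mul hδ hδ2] at h3
  rw [h2, intervalIntegral.integral_sub (by simp) (hF 0 b), intervalIntegral.integral_const,
    smul_eq_mul] at h1
  have h4 : ∫ m in (0 : ℝ)..b, φ m * ∫ x in b..1, (foldKernel δ m b - foldKernel δ m x) =
      (1 - b) * (∫ m in (0 : ℝ)..b, φ m * foldKernel δ m b) -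
        ∫ m in (0 : ℝ)..b, φ m * ∫ x in b..1, foldKernel δ m x := by
    rw [← intervalIntegral.integral_const_mul, ← intervalIntegral.integral_sub]
    · refine intervalIntegral.integral_congr fun m _ => ?_
      rw [intervalIntegral.integral_sub (by simp)
        ((continuous_foldKernel_right δ m).intervalIntegrable _ _),
        intervalIntegral.integral_const, smul_eq_mul]
      ring
    · exact (hφ.mul_continuousOn (continuous_foldKernel_left δ b).continuousOn).const_mul _
    · exact hφ.mul_continuousOn (continuous_integral_foldKernel δ b 1).continuousOn
  rw [h4, h.eqn b hb, intervalIntegral.integral_sub (hF b 1) (by simp),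
    intervalIntegral.integral_const, smul_eq_mul]
  linarith

lemma integral_foldKernel_sub_nonneg {m b : ℝ} (hm : 0 ≤ m) (hmb : m ≤ b) (hb : b ≤ 1) :
    0 ≤ ∫ x in b..1, (foldKernel δ m b - foldKernel δ m x) := by
  refine intervalIntegral.integral_nonneg hb fun x hx => ?_
  have h1 := tent_anti (δ := δ) (x := b - m) (y := x - m) (by linarith) (by linarith [hx.1])
  have h2 := tent_anti (δ := δ) (x := b + m) (y := x + m) (by linarith) (by linarith [hx.1])
  simp only [foldKernel]
  linarith

/-- At a first point `b` where `φ b ≤ 0`, the left side of `mass_identity` is nonpositive, while the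
right side is positive because `φ > 0` on `[0, b)`. -/
lemma pos (h : IsProfile δ φ) (hδ : 0 < δ) (hδ2 : δ < 2) : ∀ b ∈ Ico (0 : ℝ) 1, 0 < φ b := by
  have h0 : 0 < φ 0 := by
    have h1 := h.eqn 0 (by simp)
    have h2 := upperMass_pos hδ hδ2 le_rfl zero_lt_one
    have h3 := payoffLevel_pos hδ hδ2
    simp only [mul_zero, tentInt_zero, sub_zero, intervalIntegral.integral_same, add_zero] at h1
    by_contra hneg
    nlinarith
  by_contra! hne
  obtain ⟨c, hc, hφc⟩ := hne
  have hcc : ContinuousOn φ (Icc 0 c) :=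
    h.cont.mono fun x hx => ⟨by linarith [hx.1], hx.2.trans_lt hc.2⟩
  have hcl : IsCompact (Icc 0 c ∩ φ ⁻¹' Iic 0) :=
    isCompact_Icc.of_isClosed_subset (hcc.preimage_isClosed_of_isClosed isClosed_Icc isClosed_Iic)
      inter_subset_left
  obtain ⟨b, ⟨hb, hφb⟩, hmin⟩ := hcl.exists_isLeast ⟨c, ⟨hc.1, le_rfl⟩, hφc⟩
  have hφb : φ b ≤ 0 := hφb
  have hb1 : b < 1 := hb.2.trans_lt hc.2
  have hb0 : 0 < b := lt_of_le_of_ne hb.1 (by rintro rfl; linarith)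
  have hpos : ∀ x ∈ Ico 0 b, 0 < φ x := fun x hx => by
    by_contra! hx0
    exact absurd (hmin ⟨⟨hx.1, hx.2.le.trans hb.2⟩, hx0⟩) (not_le.2 hx.2)
  have hφ0 : ∀ x ∈ Icc 0 b, 0 ≤ φ x := by
    intro x hx
    refine ContinuousWithinAt.closure_le (s := Ico 0 b) (f := fun _ => (0 : ℝ)) (x := x)
      (by rwa [closure_Ico hb0.ne]) continuousWithinAt_const
      ((hcc x ⟨hx.1, hx.2.trans hb.2⟩).mono fun y hy => ⟨hy.1, hy.2.le.trans hb.2⟩)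
      fun y hy => (hpos y hy).le
  have hid := h.mass_identity hδ hδ2 ⟨hb.1, hb1⟩
  have hA := upperMass_pos hδ hδ2 hb.1 hb1
  have h1 : 0 ≤ ∫ y in b..1, (tentInt δ (2 * y) - tentInt δ (2 * b)) :=
    intervalIntegral.integral_nonneg hb1.le fun y hy =>
      sub_nonneg.2 (tentInt_mono (by linarith [hy.1]))
  have hKc : ContinuousOn (fun m => φ m * ∫ x in b..1, (foldKernel δ m b - foldKernel δ m x))
      (Icc 0 b) := by
    refine (hcc.mono (Icc_subset_Icc_right hb.2)).mul (Continuous.continuousOn ?_)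
    have : ∀ m, ∫ x in b..1, (foldKernel δ m b - foldKernel δ m x) =
        (1 - b) * foldKernel δ m b - ∫ x in b..1, foldKernel δ m x := fun m => by
      rw [intervalIntegral.integral_sub (by simp)
        ((continuous_foldKernel_right δ m).intervalIntegrable _ _),
        intervalIntegral.integral_const, smul_eq_mul]
    simp_rw [this]
    exact (continuous_const.mul (continuous_foldKernel_left δ b)).sub
      (continuous_integral_foldKernel δ b 1)
  -- A point below `b` at distance less than `δ`, so that the tent centred there still decreases
  -- strictly just beyond `b`.
  set m₀ := max 0 (b - δ / 2) with hm₀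
  have hm₀b : m₀ < b := max_lt hb0 (by linarith)
  have hm₀0 : 0 ≤ m₀ := le_max_left _ _
  have hm₀δ : b - m₀ < δ := by have := le_max_right 0 (b - δ / 2); linarith
  have h2 : 0 < ∫ m in (0 : ℝ)..b, φ m * ∫ x in b..1, (foldKernel δ m b - foldKernel δ m x) := by
    refine intervalIntegral.integral_pos hb0 hKc (fun m hm => mul_nonneg (hφ0 m ⟨hm.1.le, hm.2⟩)
      (integral_foldKernel_sub_nonneg hm.1.le hm.2 hb1.le)) ⟨m₀, ⟨hm₀0, hm₀b.le⟩,
      mul_pos (hpos m₀ ⟨hm₀0, hm₀b⟩) ?_⟩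
    have hK {x : ℝ} (hx : b ≤ x) : tent δ (m₀ + x) ≤ tent δ (m₀ + b) :=
      tent_anti (by linarith) (by linarith)
    refine intervalIntegral.integral_pos hb1 (Continuous.continuousOn
      (continuous_const.sub (continuous_foldKernel_right δ m₀))) (fun x hx => ?_)
      ⟨1, ⟨hb1.le, le_rfl⟩, ?_⟩
    · have h3 := tent_anti (δ := δ) (x := b - m₀) (y := x - m₀) (by linarith) (by linarith [hx.1])
      have h4 := hK hx.1.le
      simp only [foldKernel, add_comm _ m₀]
      linarith
    · have h3 := tent_lt (δ := δ) (x := b - m₀) (y := 1 - m₀) (by linarith) (by linarith) hm₀δ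
      have h4 := hK hb1.le
      simp only [foldKernel, add_comm _ m₀]
      linarith
  have h3 : φ b * upperMass δ b ≤ 0 := mul_nonpos_of_nonpos_of_nonneg hφb hA.le
  have h4 : (1 - b) * (φ b * upperMass δ b) ≤ 0 :=
    mul_nonpos_of_nonneg_of_nonpos (by linarith) h3
  linarith

end IsProfile

/-! ### Differentiating the profile equation. -/

lemma integral_fold {f : ℝ → ℝ} {b : ℝ} (h1 : IntervalIntegrable f volume (-b) 0)
    (h2 : IntervalIntegrable f volume 0 b) :
    ∫ x in (-b)..b, f x = ∫ x in (0 : ℝ)..b, (f x + f (-x)) := by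
  have h3 : IntervalIntegrable (fun x => f (-x)) volume 0 b := by
    simpa using ((IntervalIntegrable.iff_comp_neg (f := f)).1 h1).symm
  rw [← intervalIntegral.integral_add_adjacent_intervals h1 h2,
    intervalIntegral.integral_add h2 h3, intervalIntegral.integral_comp_neg, neg_zero, add_comm]

/-- The derivative of a profile multiplied by `upperMass`. -/
noncomputable def profileSlope (δ : ℝ) (φ : ℝ → ℝ) (m : ℝ) : ℝ :=
  φ m * (δ + 3 * tent δ (2 * m) + tent δ (1 - m) - tent δ (1 + m)) - 2 * tent δ (2 * m) -
    ∫ x in max (-m) (m - δ)..m, φ x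

lemma hasDerivAt_primitive {f : ℝ → ℝ} (hf : ContinuousOn f (Ioo (-1) 1)) {y : ℝ}
    (hy : y ∈ Ioo (-1 : ℝ) 1) : HasDerivAt (fun y => ∫ x in (0 : ℝ)..y, f x) (f y) y :=
  intervalIntegral.integral_hasDerivAt_right
    ((hf.mono (ordConnected_Ioo.uIcc_subset (by norm_num) hy)).intervalIntegrable)
    (hf.stronglyMeasurableAtFilter isOpen_Ioo y hy) (hf.continuousAt (isOpen_Ioo.mem_nhds hy))

lemma lower_mem {δ m : ℝ} (hδ : 0 < δ) (hm : m ∈ Ico (0 : ℝ) 1) :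
    max (-m) (m - δ) ∈ Ioo (-1 : ℝ) 1 :=
  ⟨lt_max_of_lt_left (by linarith [hm.2]), max_lt (by linarith [hm.1]) (by linarith [hm.2])⟩

namespace IsProfile

variable {δ : ℝ} {φ : ℝ → ℝ}

/-- Evenness of `φ` unfolds the kernel to a single tent on `[-m, m]`. Only its affine left branch,
on `[m - δ, m]`, contributes. -/
lemma integral_kernel_eq (h : IsProfile δ φ) (hδ : 0 < δ) {m : ℝ} (hm : m ∈ Ico (0 : ℝ) 1) :
    ∫ x in (0 : ℝ)..m, φ x * foldKernel δ x m =
      ∫ x in max (-m) (m - δ)..m, φ x * (δ - m + x) := by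
  have hm' : m ∈ Ioo (-1 : ℝ) 1 := ⟨by linarith [hm.1], hm.2⟩
  have hn' : -m ∈ Ioo (-1 : ℝ) 1 := ⟨by linarith [hm.2], by linarith [hm.1]⟩
  have hy := lower_mem hδ hm
  have h0 : (0 : ℝ) ∈ Ioo (-1 : ℝ) 1 := by norm_num
  have hc : Continuous fun x => tent δ (m - x) := by fun_prop
  have hi {a b : ℝ} (ha : a ∈ Ioo (-1 : ℝ) 1) (hb : b ∈ Ioo (-1 : ℝ) 1) :
      IntervalIntegrable (fun x => φ x * tent δ (m - x)) volume a b :=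
    (h.intervalIntegrable ha hb).mul_continuousOn hc.continuousOn
  have h1 : ∫ x in (0 : ℝ)..m, φ x * foldKernel δ x m = ∫ x in (-m)..m, φ x * tent δ (m - x) := by
    rw [integral_fold (hi hn' h0) (hi h0 hm')]
    refine intervalIntegral.integral_congr fun x _ => ?_
    simp only [foldKernel, h.even, sub_neg_eq_add, mul_add]
  rw [h1, ← intervalIntegral.integral_add_adjacent_intervals (hi hn' hy) (hi hy hm')]
  have h2 : ∫ x in (-m)..max (-m) (m - δ), φ x * tent δ (m - x) =
      ∫ x in (-m)..max (-m) (m - δ), (0 : ℝ) := by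
    refine intervalIntegral.integral_congr_ae (ae_of_all _ fun x hx => ?_)
    rw [uIoc_of_le (le_max_left _ _)] at hx
    have h3 : x ≤ m - δ := (le_max_iff.1 hx.2).resolve_left (not_le.2 hx.1)
    rw [tent_of_ge (by linarith) (by linarith), mul_zero]
  rw [h2, intervalIntegral.integral_zero, zero_add]
  refine intervalIntegral.integral_congr fun x hx => ?_
  rw [uIcc_of_le (max_le (by linarith [hm.1]) (by linarith))] at hx
  have h4 := (le_max_right _ _).trans hx.1
  rw [tent_of_mem (by linarith [hx.2]) (by linarith)]; ring

/-- Now `m` enters only through a linear factor and the limits of integration, so the fundamental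
theorem of calculus applies without differentiating the kinked kernel. -/
lemma integral_kernel_eq_sub (h : IsProfile δ φ) (hδ : 0 < δ) {m : ℝ} (hm : m ∈ Ico (0 : ℝ) 1) :
    ∫ x in (0 : ℝ)..m, φ x * foldKernel δ x m =
      (δ - m) * ((∫ x in (0 : ℝ)..m, φ x) - ∫ x in (0 : ℝ)..max (-m) (m - δ), φ x) +
        ((∫ x in (0 : ℝ)..m, x * φ x) - ∫ x in (0 : ℝ)..max (-m) (m - δ), x * φ x) := by
  have hm' : m ∈ Ioo (-1 : ℝ) 1 := ⟨by linarith [hm.1], hm.2⟩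
  have hy := lower_mem hδ hm
  have h0 : (0 : ℝ) ∈ Ioo (-1 : ℝ) 1 := by norm_num
  have hi {a b : ℝ} (ha : a ∈ Ioo (-1 : ℝ) 1) (hb : b ∈ Ioo (-1 : ℝ) 1) :
      IntervalIntegrable (fun x => x * φ x) volume a b :=
    (h.intervalIntegrable ha hb).continuousOn_mul continuous_id.continuousOn
  rw [h.integral_kernel_eq hδ hm, intervalIntegral.integral_interval_sub_left
    (h.intervalIntegrable h0 hm') (h.intervalIntegrable h0 hy),
    intervalIntegral.integral_interval_sub_left (hi h0 hm') (hi h0 hy),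
    ← intervalIntegral.integral_const_mul, ← intervalIntegral.integral_add
    ((h.intervalIntegrable hy hm').const_mul _) (hi hy hm')]
  refine intervalIntegral.integral_congr fun x _ => ?_
  ring

/-- The lower limit changes from `-m` to `m - δ` at `m = δ / 2`. Its boundary term is `φ m * (δ - 2
* m)` on the first branch and zero on the second; both equal `φ m * tent δ (2 * m)`, so the
one-sided derivatives agree at the kink. -/
lemma hasDerivAt_integral_kernel (h : IsProfile δ φ) (hδ : 0 < δ) (hδ2 : δ < 2) {m : ℝ}
    (hm : m ∈ Ioo (0 : ℝ) 1) :
    HasDerivAt (fun m => ∫ x in (0 : ℝ)..m, φ x * foldKernel δ x m)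
      (φ m * (δ + tent δ (2 * m)) - ∫ x in max (-m) (m - δ)..m, φ x) m := by
  have hm' : m ∈ Ioo (-1 : ℝ) 1 := ⟨by linarith [hm.1], hm.2⟩
  have h0 : (0 : ℝ) ∈ Ioo (-1 : ℝ) 1 := by norm_num
  have hxc : ContinuousOn (fun x => x * φ x) (Ioo (-1) 1) := continuousOn_id.mul h.cont
  have hev : ∀ s : Set ℝ, ∀ᶠ x in nhdsWithin m s, x ∈ Ioo (0 : ℝ) 1 := fun s =>
    nhdsWithin_le_nhds (isOpen_Ioo.mem_nhds hm)
  have key : ∀ (y' : ℝ) (y : ℝ → ℝ), HasDerivAt y y' m → y m ∈ Ioo (-1 : ℝ) 1 →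
      HasDerivAt (fun m => (δ - m) * ((∫ x in (0 : ℝ)..m, φ x) - ∫ x in (0 : ℝ)..y m, φ x) +
        ((∫ x in (0 : ℝ)..m, x * φ x) - ∫ x in (0 : ℝ)..y m, x * φ x))
        (φ m * δ - φ (y m) * y' * (δ - m + y m) - ∫ x in (y m)..m, φ x) m := by
    intro y' y hy hym
    have e1 := hasDerivAt_primitive h.cont hm'
    have e2 := (hasDerivAt_primitive h.cont hym).comp m hy
    have e3 := hasDerivAt_primitive hxc hm'
    have e4 := (hasDerivAt_primitive hxc hym).comp m hy
    have e5 := ((hasDerivAt_id m).const_sub δ).mul (e1.sub e2)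
    refine (e5.add (e3.sub e4)).congr_deriv ?_
    rw [← intervalIntegral.integral_interval_sub_left (h.intervalIntegrable h0 hm')
      (h.intervalIntegrable h0 hym)]
    simp only [Function.comp, id, Pi.sub_apply]
    ring
  have hlow : m ≤ δ / 2 → HasDerivWithinAt (fun m => ∫ x in (0 : ℝ)..m, φ x * foldKernel δ x m)
      (φ m * (δ + tent δ (2 * m)) - ∫ x in max (-m) (m - δ)..m, φ x) (Iic (δ / 2)) m := by
    intro hmδ
    have hmax : ∀ x, x ≤ δ / 2 → max (-x) (x - δ) = -x := fun x hx => max_eq_left (by linarith)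
    have e := (key (-1) (fun x => -x) (hasDerivAt_neg m)
      ⟨by linarith [hm.2], by linarith [hm.1]⟩).hasDerivWithinAt (s := Iic (δ / 2))
    refine (e.congr_of_eventuallyEq ?_ ?_).congr_deriv ?_
    · filter_upwards [hev (Iic (δ / 2)), self_mem_nhdsWithin] with x hx hx2
      rw [h.integral_kernel_eq_sub hδ ⟨hx.1.le, hx.2⟩, hmax x hx2]
    · rw [h.integral_kernel_eq_sub hδ ⟨hm.1.le, hm.2⟩, hmax m hmδ]
    · rw [hmax m hmδ, h.even, tent_of_mem (by linarith [hm.1]) (by linarith)]; ring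
  have hhigh : δ / 2 ≤ m → HasDerivWithinAt (fun m => ∫ x in (0 : ℝ)..m, φ x * foldKernel δ x m)
      (φ m * (δ + tent δ (2 * m)) - ∫ x in max (-m) (m - δ)..m, φ x) (Ici (δ / 2)) m := by
    intro hmδ
    have hmax : ∀ x, δ / 2 ≤ x → max (-x) (x - δ) = x - δ := fun x hx =>
      max_eq_right (by linarith)
    have e := (key 1 (fun x => x - δ) ((hasDerivAt_id m).sub_const δ)
      ⟨by linarith, by linarith [hm.2]⟩).hasDerivWithinAt (s := Ici (δ / 2))
    refine (e.congr_of_eventuallyEq ?_ ?_).congr_deriv ?_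
    · filter_upwards [hev (Ici (δ / 2)), self_mem_nhdsWithin] with x hx hx2
      rw [h.integral_kernel_eq_sub hδ ⟨hx.1.le, hx.2⟩, hmax x hx2]
    · rw [h.integral_kernel_eq_sub hδ ⟨hm.1.le, hm.2⟩, hmax m hmδ]
    · rw [hmax m hmδ, tent_of_ge (by linarith [hm.1]) (by linarith)]; ring
  rcases lt_trichotomy m (δ / 2) with hlt | heq | hgt
  · exact (hlow hlt.le).hasDerivAt (Iic_mem_nhds hlt)
  · have := (hlow heq.le).union (hhigh heq.ge)
    rwa [Iic_union_Ici, hasDerivWithinAt_univ] at this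
  · exact (hhigh hgt.le).hasDerivAt (Ici_mem_nhds hgt)

lemma hasDerivAt (h : IsProfile δ φ) (hδ : 0 < δ) (hδ2 : δ < 2) {m : ℝ} (hm : m ∈ Ioo (0 : ℝ) 1) :
    HasDerivAt φ (profileSlope δ φ m / upperMass δ m) m := by
  have hA := upperMass_pos hδ hδ2 hm.1.le hm.2
  have d2 : HasDerivAt (fun m : ℝ => 2 * m) 2 m := by simpa using (hasDerivAt_id m).const_mul 2
  have dm : HasDerivAt (fun m : ℝ => 1 - m) (-1) m := by simpa using (hasDerivAt_id m).const_sub 1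
  have dp : HasDerivAt (fun m : ℝ => 1 + m) 1 m := by simpa using (hasDerivAt_id m).const_add 1
  have f2 := (hasDerivAt_tentInt δ (2 * m)).comp m d2
  have fm := (hasDerivAt_tentInt δ (1 - m)).comp m dm
  have fp := (hasDerivAt_tentInt δ (1 + m)).comp m dp
  have hN := (f2.const_sub (payoffLevel δ)).add (h.hasDerivAt_integral_kernel hδ hδ2 hm)
  have hAd : HasDerivAt (upperMass δ) _ m := (fm.add fp).sub f2
  have hq := hN.div hAd hA.ne'
  have hev : ∀ x ∈ Ico (0 : ℝ) 1, φ x = (payoffLevel δ - tentInt δ (2 * x) +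
      ∫ y in (0 : ℝ)..x, φ y * foldKernel δ y x) / upperMass δ x := fun x hx => by
    rw [← h.eqn x hx, mul_div_cancel_right₀ _ (upperMass_pos hδ hδ2 hx.1 hx.2).ne']
  refine (hq.congr_of_eventuallyEq ?_).congr_deriv ?_
  · filter_upwards [isOpen_Ioo.mem_nhds hm] with x hx
    exact hev x ⟨hx.1.le, hx.2⟩
  · have he := h.eqn m ⟨hm.1.le, hm.2⟩
    simp only [Function.comp, Pi.add_apply]
    rw [← he, profileSlope, div_eq_div_iff (pow_pos hA 2).ne' hA.ne']
    ring

lemma continuousOn_profileSlope (h : IsProfile δ φ) (hδ : 0 < δ) :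
    ContinuousOn (profileSlope δ φ) (Ico 0 1) := by
  have hsub : Ico (0 : ℝ) 1 ⊆ Ioo (-1) 1 := fun x hx => ⟨by linarith [hx.1], hx.2⟩
  have hP : ContinuousOn (fun y => ∫ x in (0 : ℝ)..y, φ x) (Ioo (-1) 1) := fun y hy =>
    (hasDerivAt_primitive h.cont hy).continuousAt.continuousWithinAt
  have hI : ContinuousOn (fun m => ∫ x in max (-m) (m - δ)..m, φ x) (Ico 0 1) := by
    have h1 : ContinuousOn (fun m => (∫ x in (0 : ℝ)..m, φ x) -
        ∫ x in (0 : ℝ)..max (-m) (m - δ), φ x) (Ico 0 1) :=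
      (hP.mono hsub).sub (hP.comp (by fun_prop) fun m hm => lower_mem hδ hm)
    refine h1.congr fun m hm => ?_
    exact (intervalIntegral.integral_interval_sub_left (h.intervalIntegrable (by norm_num) (hsub hm))
      (h.intervalIntegrable (by norm_num) (lower_mem hδ hm))).symm
  have hφ := h.cont.mono hsub
  exact ((hφ.mul (Continuous.continuousOn (by fun_prop))).sub
    (Continuous.continuousOn (by fun_prop))).sub hI

/-- The window of integration has length `δ - tent δ (2 * m)`, so `φ m` can be subtracted inside the
integral. The sign of each term can then be read off from `φ m < 1 / 2` or from comparing `φ` with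
`φ m`. -/
lemma profileSlope_eq (h : IsProfile δ φ) (hδ : 0 < δ) {m : ℝ} (hm : m ∈ Ico (0 : ℝ) 1) :
    profileSlope δ φ m = -2 * tent δ (2 * m) * (1 - 2 * φ m) +
      φ m * (tent δ (1 - m) - tent δ (1 + m)) - ∫ x in max (-m) (m - δ)..m, (φ x - φ m) := by
  have hm' : m ∈ Ioo (-1 : ℝ) 1 := ⟨by linarith [hm.1], hm.2⟩
  have h1 : δ = m - max (-m) (m - δ) + tent δ (2 * m) := by
    rcases le_total m (δ / 2) with h2 | h2
    · rw [tent_of_mem (by linarith [hm.1]) (by linarith), max_eq_left (by linarith)]; ring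
    · rw [tent_of_ge (by linarith [hm.1]) (by linarith), max_eq_right (by linarith)]; ring
  rw [intervalIntegral.integral_sub (h.intervalIntegrable (lower_mem hδ hm) hm') (by simp),
    intervalIntegral.integral_const, smul_eq_mul, profileSlope]
  linear_combination φ m * h1

end IsProfile

/-! ### Strict monotonicity of the profile. -/

lemma exists_isLeast_nonneg {f : ℝ → ℝ} {a b c : ℝ} (hf : ContinuousOn f (Icc a b))
    (hc : c ∈ Icc a b) (hfc : 0 ≤ f c) :
    ∃ d ∈ Icc a b, 0 ≤ f d ∧ ∀ x ∈ Ico a d, f x < 0 := by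
  obtain ⟨d, ⟨hd, hfd⟩, hmin⟩ := (isCompact_Icc.of_isClosed_subset
    (hf.preimage_isClosed_of_isClosed isClosed_Icc isClosed_Ici)
    inter_subset_left).exists_isLeast ⟨c, hc, hfc⟩
  refine ⟨d, hd, hfd, fun x hx => ?_⟩
  by_contra! hx0
  exact absurd (hmin ⟨⟨hx.1, hx.2.le.trans hd.2⟩, hx0⟩) (not_le.2 hx.2)

lemma exists_isGreatest_nonneg {f : ℝ → ℝ} {a b c : ℝ} (hf : ContinuousOn f (Icc a b))
    (hc : c ∈ Icc a b) (hfc : 0 ≤ f c) :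
    ∃ d ∈ Icc a b, 0 ≤ f d ∧ ∀ x ∈ Ioc d b, f x < 0 := by
  obtain ⟨d, ⟨hd, hfd⟩, hmax⟩ := (isCompact_Icc.of_isClosed_subset
    (hf.preimage_isClosed_of_isClosed isClosed_Icc isClosed_Ici)
    inter_subset_left).exists_isGreatest ⟨c, hc, hfc⟩
  refine ⟨d, hd, hfd, fun x hx => ?_⟩
  by_contra! hx0
  exact absurd (hmax ⟨⟨hd.1.trans hx.1.le, hx.2⟩, hx0⟩) (not_le.2 hx.1)

namespace IsProfile

variable {δ : ℝ} {φ : ℝ → ℝ}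

lemma Ico_subset_Ioo : Ico (0 : ℝ) 1 ⊆ Ioo (-1) 1 := fun _ hx => ⟨by linarith [hx.1], hx.2⟩

lemma apply_abs (h : IsProfile δ φ) (x : ℝ) : φ |x| = φ x := by
  rcases abs_choice x with hx | hx <;> rw [hx]
  exact h.even x

lemma apply_zero_eq (h : IsProfile δ φ) : φ 0 * (2 * tentInt δ 1) = payoffLevel δ := by
  have h1 := h.eqn 0 (by simp)
  simp only [upperMass, mul_zero, tentInt_zero, sub_zero, add_zero,
    intervalIntegral.integral_same] at h1
  linarith

lemma apply_zero_lt (h : IsProfile δ φ) (hδ : 0 < δ) : φ 0 < 1 / 2 := by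
  have h1 := h.apply_zero_eq
  have h2 := payoffLevel_lt hδ
  have h3 : 0 ≤ tentInt δ 1 := by rw [← tentInt_zero δ]; exact tentInt_mono zero_le_one
  by_contra! hne
  nlinarith

lemma profileSlope_zero_neg (h : IsProfile δ φ) (hδ : 0 < δ) : profileSlope δ φ 0 < 0 := by
  have h1 := h.apply_zero_lt hδ
  rw [profileSlope]
  simp only [mul_zero, tent_zero hδ, sub_zero, add_zero, neg_zero, zero_sub,
    max_eq_left (neg_nonpos.2 hδ.le), intervalIntegral.integral_same]
  nlinarith

lemma strictAntiOn_of_profileSlope_neg (h : IsProfile δ φ) (hδ : 0 < δ) (hδ2 : δ < 2) {D : Set ℝ}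
    (hD : Convex ℝ D) (hD1 : D ⊆ Ico 0 1) (hneg : ∀ x ∈ interior D, profileSlope δ φ x < 0) :
    StrictAntiOn φ D := by
  refine strictAntiOn_of_deriv_neg hD (h.cont.mono (hD1.trans Ico_subset_Ioo)) fun x hx => ?_
  have hx1 : x ∈ Ioo (0 : ℝ) 1 := by
    have := interior_mono hD1 hx
    rwa [interior_Ico] at this
  rw [(h.hasDerivAt hδ hδ2 hx1).deriv]
  exact div_neg_of_neg_of_pos (hneg x hx) (upperMass_pos hδ hδ2 hx1.1.le hx1.2)

/-- Here `tentInt δ (2 * y)` is constant on `[m, 1]`, so `mass_identity` writes `φ m` as a weighted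
integral of `φ` over `[m - δ, m]`. The tent is 1-Lipschitz, which bounds the weight by `t ^ 2 / 2`
with `t = 1 - m`; this is exactly the bound needed. -/
lemma profileSlope_neg_of_ge (h : IsProfile δ φ) (hδ : 0 < δ) (hδ2 : δ < 2) {m : ℝ} (hm1 : m < 1)
    (hm : δ / 2 ≤ m) (hm' : 1 - δ ≤ m) : profileSlope δ φ m < 0 := by
  have hm0 : 0 < m := by linarith
  have hmI : m ∈ Ico (0 : ℝ) 1 := ⟨hm0.le, hm1⟩
  have hmI' := Ico_subset_Ioo hmI
  have hnI : -m ∈ Ioo (-1 : ℝ) 1 := ⟨by linarith, by linarith⟩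
  have hdI : m - δ ∈ Ioo (-1 : ℝ) 1 := ⟨by linarith, by linarith⟩
  have h0I : (0 : ℝ) ∈ Ioo (-1 : ℝ) 1 := by norm_num
  have hid := h.mass_identity hδ hδ2 hmI
  set t := 1 - m with ht
  have ht0 : 0 < t := by linarith
  have hz : ∫ y in m..1, (tentInt δ (2 * y) - tentInt δ (2 * m)) = ∫ y in m..1, (0 : ℝ) := by
    refine intervalIntegral.integral_congr fun y hy => ?_
    rw [uIcc_of_le hm1.le] at hy
    rw [tentInt_of_ge hδ (by linarith [hy.1]), tentInt_of_ge hδ (by linarith), sub_self]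
  have hA : upperMass δ m = t * δ - t ^ 2 / 2 := by
    rw [upperMass, tentInt_of_ge hδ (by linarith : δ ≤ 1 + m),
      tentInt_of_ge hδ (by linarith : δ ≤ 2 * m), tentInt_of_mem ht0.le (by linarith)]
    ring
  let D : ℝ → ℝ := fun x => t * tent δ (m - x) - (tentInt δ (1 - x) - tentInt δ (m - x))
  have hDc : Continuous D := by fun_prop
  have hD : ∀ x, D x = ∫ y in m..1, (tent δ (m - x) - tent δ (y - x)) := fun x => by
    have hc : Continuous fun y => tent δ (y - x) := by fun_prop
    rw [intervalIntegral.integral_sub (by simp) (hc.intervalIntegrable _ _),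
      intervalIntegral.integral_const, integral_tent_sub, smul_eq_mul]
  have hi {a b : ℝ} (ha : a ∈ Ioo (-1 : ℝ) 1) (hb : b ∈ Ioo (-1 : ℝ) 1) :
      IntervalIntegrable (fun x => φ x * D x) volume a b :=
    (h.intervalIntegrable ha hb).mul_continuousOn hDc.continuousOn
  have h1 : ∫ x in (0 : ℝ)..m, φ x * ∫ y in m..1, (foldKernel δ x m - foldKernel δ x y) =
      ∫ x in (-m)..m, φ x * D x := by
    rw [integral_fold (hi hnI h0I) (hi h0I hmI')]
    refine intervalIntegral.integral_congr fun x _ => ?_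
    have hc (x : ℝ) : IntervalIntegrable (fun y => tent δ (m - x) - tent δ (y - x)) volume m 1 :=
      Continuous.intervalIntegrable (by fun_prop) _ _
    rw [hD, hD, h.even, ← mul_add, ← intervalIntegral.integral_add (hc x) (hc (-x))]
    congr 1
    refine intervalIntegral.integral_congr fun y _ => ?_
    simp only [foldKernel, sub_neg_eq_add]
    ring
  have h2 : ∫ x in (-m)..(m - δ), φ x * D x = ∫ x in (-m)..(m - δ), (0 : ℝ) := by
    refine intervalIntegral.integral_congr fun x hx => ?_
    rw [uIcc_of_le (by linarith)] at hx
    simp only [D]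
    rw [tent_of_ge (by linarith [hx.2]) (by linarith [hx.2]),
      tentInt_of_ge hδ (by linarith [hx.2]), tentInt_of_ge hδ (by linarith [hx.2])]
    ring
  have hpos : ∀ x ∈ Icc (m - δ) m, 0 < φ x := fun x hx => by
    rw [← h.apply_abs]
    exact h.pos hδ hδ2 _ ⟨abs_nonneg x, (abs_le.2 ⟨by linarith [hx.1], hx.2⟩).trans_lt hm1⟩
  have hφc : ContinuousOn φ (Icc (m - δ) m) :=
    h.cont.mono fun x hx => ⟨by linarith [hx.1], by linarith [hx.2]⟩
  have hlin : ∫ y in m..1, (y - m) = t ^ 2 / 2 := by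
    rw [intervalIntegral.integral_comp_sub_right (fun y => y)]
    simp [ht]
  -- Strictness comes from `x = m - δ`, where `D` vanishes and `φ` is positive.
  have h3 : ∫ x in (m - δ)..m, φ x * D x < ∫ x in (m - δ)..m, φ x * (t ^ 2 / 2) := by
    refine intervalIntegral.integral_lt_integral_of_continuousOn_of_le_of_exists_lt (by linarith)
      (hφc.mul hDc.continuousOn) (hφc.mul continuousOn_const) (fun x hx => ?_)
      ⟨m - δ, ⟨le_rfl, by linarith⟩, ?_⟩
    · refine mul_le_mul_of_nonneg_left ?_ (hpos x ⟨hx.1.le, hx.2⟩).le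
      rw [hD, ← hlin]
      refine intervalIntegral.integral_mono_on hm1.le
        (Continuous.intervalIntegrable (by fun_prop) _ _)
        (Continuous.intervalIntegrable (by fun_prop) _ _) fun y hy => ?_
      have := tent_sub_le (δ := δ) (x := m - x) (y := y - x) (by linarith [hx.2])
        (by linarith [hy.1])
      linarith
    · refine mul_lt_mul_of_pos_left ?_ (hpos _ ⟨le_rfl, by linarith⟩)
      simp only [D, sub_sub_cancel]
      rw [tent_of_ge hδ.le le_rfl, tentInt_of_ge hδ le_rfl, tentInt_of_ge hδ (by linarith)]
      have : 0 < t ^ 2 := by positivity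
      linarith
  rw [hz, h1, ← intervalIntegral.integral_add_adjacent_intervals (hi hnI hdI) (hi hdI hmI'), h2,
    intervalIntegral.integral_zero, intervalIntegral.integral_zero, zero_add, zero_add, hA] at hid
  rw [← hid, intervalIntegral.integral_mul_const] at h3
  rw [profileSlope, max_eq_right (by linarith), tent_of_ge (by linarith) (by linarith : δ ≤ 2 * m),
    tent_of_ge (by linarith) (by linarith : δ ≤ 1 + m), ← ht, tent_of_mem ht0.le (by linarith)]
  have h4 : t ^ 2 / 2 * (φ m * (2 * δ - t)) < t ^ 2 / 2 * ∫ x in (m - δ)..m, φ x := by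
    linarith
  have h5 := lt_of_mul_lt_mul_left h4 (by positivity)
  linarith

/-- Up to the first failure `b`, `φ` decreases from `φ 0 < 1 / 2`. Since `1 - b ≥ δ`, the boundary
tents in `profileSlope_eq` vanish and the other terms make the slope negative at `b`, a
contradiction. -/
lemma profileSlope_neg_of_le_one_sub (h : IsProfile δ φ) (hδ : 0 < δ) (hδ2 : δ < 2) {m : ℝ}
    (hm0 : 0 ≤ m) (hm : m ≤ 1 - δ) : profileSlope δ φ m < 0 := by
  by_contra! hne
  have hsub : Icc 0 (1 - δ) ⊆ Ico (0 : ℝ) 1 := fun x hx => ⟨hx.1, by linarith [hx.2]⟩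
  obtain ⟨b, hb, hsb, hlt⟩ := exists_isLeast_nonneg ((h.continuousOn_profileSlope hδ).mono hsub)
    ⟨hm0, hm⟩ hne
  have hb0 : 0 < b := lt_of_le_of_ne hb.1 (by
    rintro rfl; exact absurd (h.profileSlope_zero_neg hδ) (not_lt.2 hsb))
  have hb1 := hsub hb
  have hanti : StrictAntiOn φ (Icc 0 b) := by
    refine h.strictAntiOn_of_profileSlope_neg hδ hδ2 (convex_Icc 0 b)
      ((Icc_subset_Icc_right hb.2).trans hsub) fun x hx => ?_
    rw [interior_Icc] at hx
    exact hlt x ⟨hx.1.le, hx.2⟩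
  have hφb : φ b < 1 / 2 :=
    (hanti ⟨le_rfl, hb.1⟩ ⟨hb.1, le_rfl⟩ hb0).trans (h.apply_zero_lt hδ)
  have hy := lower_mem hδ hb1
  have hyb : max (-b) (b - δ) < b := max_lt (by linarith) (by linarith)
  have hint : 0 < ∫ x in max (-b) (b - δ)..b, (φ x - φ b) := by
    refine intervalIntegral.integral_pos hyb ((h.cont.mono fun x hx => ?_).sub continuousOn_const)
      (fun x hx => ?_) ⟨max 0 (b - δ), ⟨max_le_max (by linarith) le_rfl, max_le hb.1 (by linarith)⟩,
        sub_pos.2 (hanti ⟨le_max_left _ _, max_le hb.1 (by linarith)⟩ ⟨hb.1, le_rfl⟩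
          (max_lt hb0 (by linarith)))⟩
    · exact ⟨hy.1.trans_le hx.1, hx.2.trans_lt hb1.2⟩
    · have hxb : |x| ≤ b := abs_le.2 ⟨(le_max_left _ _).trans hx.1.le, hx.2⟩
      rw [sub_nonneg, ← h.apply_abs x]
      exact hanti.antitoneOn ⟨abs_nonneg x, hxb⟩ ⟨hb.1, le_rfl⟩ hxb
  rw [h.profileSlope_eq hδ hb1, tent_of_ge (by linarith [hb1.2]) (by linarith [hb.2] : δ ≤ 1 - b),
    tent_of_ge (by linarith [hb1.1]) (by linarith [hb.1, hb.2] : δ ≤ 1 + b)] at hsb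
  nlinarith [tent_nonneg δ (2 * b)]

/-- At a maximum `b` with `φ b ≥ 1 / 2`, every term of `profileSlope_eq` is nonnegative and the
integral term is strictly positive. An interior maximum has zero slope, and at `δ / 2` the slope is
negative by `profileSlope_neg_of_ge`. -/
lemma lt_half_of_le (h : IsProfile δ φ) (hδ : 0 < δ) (hδ2 : δ < 2) (hδ3 : 1 - δ ≤ δ / 2) {m : ℝ}
    (hm : m ∈ Icc 0 (δ / 2)) : φ m < 1 / 2 := by
  have hsub : Icc 0 (δ / 2) ⊆ Ico (0 : ℝ) 1 := fun x hx => ⟨hx.1, by linarith [hx.2]⟩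
  obtain ⟨b, hb, hmax⟩ := isCompact_Icc.exists_isMaxOn ⟨m, hm⟩
    (h.cont.mono (hsub.trans Ico_subset_Ioo))
  refine (hmax hm).trans_lt ?_
  by_contra! hne
  have hb0 : 0 < b := lt_of_le_of_ne hb.1 (by
    rintro rfl; exact absurd (h.apply_zero_lt hδ) (not_lt.2 hne))
  have hb1 := hsub hb
  have hint : 0 < ∫ x in (-b)..b, (φ b - φ x) := by
    refine intervalIntegral.integral_pos (by linarith)
      (continuousOn_const.sub (h.cont.mono fun x hx => ?_)) (fun x hx => ?_)
      ⟨0, ⟨by linarith, hb.1⟩, by linarith [h.apply_zero_lt hδ]⟩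
    · exact ⟨by linarith [hx.1, hb1.2], hx.2.trans_lt hb1.2⟩
    · have hxb : |x| ≤ b := abs_le.2 ⟨hx.1.le, hx.2⟩
      rw [sub_nonneg, ← h.apply_abs x]
      exact hmax ⟨abs_nonneg x, hxb.trans hb.2⟩
  have hslope : 0 < profileSlope δ φ b := by
    have h1 : ∫ x in (-b)..b, (φ x - φ b) = - ∫ x in (-b)..b, (φ b - φ x) := by
      rw [← intervalIntegral.integral_neg]; simp
    have h2 := tent_anti (δ := δ) (x := 1 - b) (y := 1 + b) (by linarith [hb1.2]) (by linarith)
    rw [h.profileSlope_eq hδ hb1, max_eq_left (by linarith [hb.2]), h1]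
    have h3 := tent_nonneg δ (2 * b)
    have h4 := h.pos hδ hδ2 b hb1
    nlinarith [mul_nonneg h4.le (sub_nonneg.2 h2), mul_nonneg h3 (by linarith : 0 ≤ 2 * φ b - 1)]
  rcases hb.2.eq_or_lt with rfl | hlt
  · exact absurd (h.profileSlope_neg_of_ge hδ hδ2 hb1.2 le_rfl hδ3) (not_lt.2 hslope.le)
  · have h0 := (hmax.isLocalMax (Icc_mem_nhds hb0 hlt)).hasDerivAt_eq_zero
      (h.hasDerivAt hδ hδ2 ⟨hb0, hb1.2⟩)
    exact absurd h0 (div_pos hslope (upperMass_pos hδ hδ2 hb1.1 hb1.2)).ne'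

/-- Take the last point `b` where the slope is nonnegative. The slope vanishes there, hence so does
`φ'`. Differentiating the slope formula at `b`, with its boundary tents frozen, gives `4 - 8 * φ b >
0`, against the slope being negative to the right of `b`. -/
lemma profileSlope_neg_of_le_half (h : IsProfile δ φ) (hδ : 0 < δ) (hδ2 : δ < 2)
    (hδ3 : 1 - δ ≤ δ / 2) {m : ℝ} (hm : m ∈ Icc 0 (δ / 2)) : profileSlope δ φ m < 0 := by
  by_contra! hne
  have hsub : Icc 0 (δ / 2) ⊆ Ico (0 : ℝ) 1 := fun x hx => ⟨hx.1, by linarith [hx.2]⟩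
  have hsc := (h.continuousOn_profileSlope hδ).mono hsub
  obtain ⟨b, hb, hsb, hlt⟩ := exists_isGreatest_nonneg hsc hm hne
  have hb1 := hsub hb
  have hbδ : b < δ / 2 := lt_of_le_of_ne hb.2 (by
    rintro rfl
    exact absurd (h.profileSlope_neg_of_ge hδ hδ2 hb1.2 le_rfl hδ3) (not_lt.2 hsb))
  have hb0 : 0 < b := lt_of_le_of_ne hb.1 (by
    rintro rfl; exact absurd (h.profileSlope_zero_neg hδ) (not_lt.2 hsb))
  have hs0 : profileSlope δ φ b = 0 := by
    refine le_antisymm ?_ hsb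
    exact ContinuousWithinAt.closure_le (s := Ioc b (δ / 2)) (g := fun _ => (0 : ℝ))
      (by rw [closure_Ioc hbδ.ne]; exact ⟨le_rfl, hbδ.le⟩)
      ((hsc b hb).mono fun y hy => ⟨hb.1.trans hy.1.le, hy.2⟩) continuousWithinAt_const
      fun y hy => (hlt y hy).le
  -- Freezing the boundary tents at `b` avoids differentiating them at a possible kink.
  set E := tent δ (1 - b) - tent δ (1 + b) with hE
  let V : ℝ → ℝ := fun x => φ x * (4 * δ - 6 * x + E) - 2 * (δ - 2 * x) - 2 * ∫ y in (0 : ℝ)..x, φ y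
  have hsl : ∀ x ∈ Icc 0 (δ / 2), profileSlope δ φ x =
      φ x * (4 * δ - 6 * x + (tent δ (1 - x) - tent δ (1 + x))) - 2 * (δ - 2 * x) -
        2 * ∫ y in (0 : ℝ)..x, φ y := by
    intro x hx
    have hx1 := hsub hx
    have h1 : ∫ y in (-x)..x, φ y = 2 * ∫ y in (0 : ℝ)..x, φ y := by
      rw [integral_fold (h.intervalIntegrable ⟨by linarith [hx1.2], by linarith [hx1.1]⟩
        (by norm_num)) (h.intervalIntegrable (by norm_num) (Ico_subset_Ioo hx1)),
        ← intervalIntegral.integral_const_mul]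
      simp_rw [h.even, two_mul]
    rw [profileSlope, max_eq_left (by linarith [hx.2]), h1,
      tent_of_mem (by linarith [hx.1]) (by linarith [hx.2] : 2 * x ≤ δ)]
    ring
  have hVb : V b = 0 := by rw [← hs0, hsl b hb]
  have hφ' : HasDerivAt φ 0 b := by
    have := h.hasDerivAt hδ hδ2 ⟨hb0, hb1.2⟩
    rwa [hs0, zero_div] at this
  have hV : HasDerivAt V (4 - 8 * φ b) b := by
    have d1 : HasDerivAt (fun x : ℝ => 4 * δ - 6 * x + E) (-6) b := by
      simpa using (((hasDerivAt_id b).const_mul 6).const_sub (4 * δ)).add_const E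
    have d2 : HasDerivAt (fun x : ℝ => 2 * (δ - 2 * x)) (-4) b := by
      refine ((((hasDerivAt_id b).const_mul 2).const_sub δ).const_mul 2).congr_deriv ?_
      ring
    have d3 := (hasDerivAt_primitive h.cont (Ico_subset_Ioo hb1)).const_mul 2
    refine (((hφ'.mul d1).sub d2).sub d3).congr_deriv ?_
    ring
  -- The difference `tent δ (1 - x) - tent δ (1 + x)` is nondecreasing in `x`, so with `φ x > 0` the
  -- frozen expression `V x` is at most the true slope.
  have hVneg : ∀ x ∈ Ioc b (δ / 2), V x < 0 := by
    intro x hx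
    have hx0 : x ∈ Icc 0 (δ / 2) := ⟨hb.1.trans hx.1.le, hx.2⟩
    have hx1 := hsub hx0
    have h1 := hlt x hx
    rw [hsl x hx0] at h1
    have h2 := tent_anti (δ := δ) (x := 1 - x) (y := 1 - b) (by linarith [hx1.2]) (by linarith [hx.1])
    have h3 := tent_anti (δ := δ) (x := 1 + b) (y := 1 + x) (by linarith) (by linarith [hx.1])
    have h4 : 0 ≤ φ x * (tent δ (1 - x) - tent δ (1 + x) - E) :=
      mul_nonneg (h.pos hδ hδ2 x hx1).le (by linarith)
    simp only [V]
    linarith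
  have hlim := hasDerivWithinAt_iff_tendsto_slope' (s := Ioi b) (by simp) |>.1
    hV.hasDerivWithinAt
  have hle : 4 - 8 * φ b ≤ 0 := by
    refine le_of_tendsto hlim ?_
    filter_upwards [Ioc_mem_nhdsGT hbδ] with x hx
    rw [slope_def_field, hVb, sub_zero]
    exact (div_neg_of_neg_of_pos (hVneg x hx) (sub_pos.2 hx.1)).le
  linarith [h.lt_half_of_le hδ hδ2 hδ3 hb]

lemma strictAntiOn (h : IsProfile δ φ) (hδ : 0 < δ) (hδ2 : δ < 2) : StrictAntiOn φ (Ico 0 1) := by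
  refine h.strictAntiOn_of_profileSlope_neg hδ hδ2 (convex_Ico 0 1) subset_rfl fun x hx => ?_
  replace hx := interior_subset hx
  rcases le_total (1 - δ) (δ / 2) with h1 | h1
  · rcases le_total x (δ / 2) with h2 | h2
    · exact h.profileSlope_neg_of_le_half hδ hδ2 h1 ⟨hx.1, h2⟩
    · exact h.profileSlope_neg_of_ge hδ hδ2 hx.2 h2 (h1.trans h2)
  · rcases le_total x (1 - δ) with h2 | h2
    · exact h.profileSlope_neg_of_le_one_sub hδ hδ2 hx.1 h2
    · exact h.profileSlope_neg_of_ge hδ hδ2 hx.2 (h1.trans h2) h2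

end IsProfile

/-! ### The quack's payoff as a function of his message. -/

/-- The quack's payoff from a message of absolute value `m`, up to normalization. -/
noncomputable def payoffCurve (δ : ℝ) (φ : ℝ → ℝ) (m : ℝ) : ℝ :=
  φ m * upperMass δ m + tentInt δ (2 * m) - ∫ x in (0 : ℝ)..m, φ x * foldKernel δ x m

/-- The probability that a quack with message `m` is selected against the expert's message `ω`
when both are consistent. -/
noncomputable def quackShare (φ : ℝ → ℝ) (m ω : ℝ) : ℝ :=
  if |m| < |ω| then φ |m| else 1 - φ |ω|

open Classical in
/-- The probability that the quack is selected given the state and the noise. -/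
noncomputable def quackSelection (ε : ℝ) (φ : ℝ → ℝ) (m : ℝ) (p : ℝ × ℝ) : ℝ :=
  if Consistent ε m (p.1 + p.2) then quackShare φ m p.1 else 0

section Payoff

variable {ε : ℝ} {φ : ℝ → ℝ} {m : ℝ}

lemma stateLaw_eq : stateLaw = ENNReal.ofReal (1 / 2) • volume.restrict (Icc (-1 : ℝ) 1) := by
  rw [stateLaw, ProbabilityTheory.cond, Real.volume_Icc, ← ENNReal.ofReal_inv_of_pos (by norm_num)]
  norm_num

lemma noiseLaw_eq (hε : 0 < ε) :
    noiseLaw ε = ENNReal.ofReal (1 / (2 * ε)) • volume.restrict (Icc (-ε) ε) := by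
  rw [noiseLaw, ProbabilityTheory.cond, Real.volume_Icc,
    ← ENNReal.ofReal_inv_of_pos (by linarith)]
  congr 2
  field_simp
  ring

lemma isProbabilityMeasure_stateLaw : IsProbabilityMeasure stateLaw :=
  cond_isProbabilityMeasure_of_finite (by rw [Real.volume_Icc]; norm_num)
    (by rw [Real.volume_Icc]; exact ENNReal.ofReal_ne_top)

lemma isProbabilityMeasure_noiseLaw (hε : 0 < ε) : IsProbabilityMeasure (noiseLaw ε) :=
  cond_isProbabilityMeasure_of_finite
    (by rw [Real.volume_Icc, Ne, ENNReal.ofReal_eq_zero]; linarith)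
    (by rw [Real.volume_Icc]; exact ENNReal.ofReal_ne_top)

lemma ae_stateLaw (m : ℝ) : ∀ᵐ ω ∂stateLaw, ω ∈ Icc (-1 : ℝ) 1 ∧ |ω| ≠ |m| := by
  rw [stateLaw_eq]
  refine Measure.ae_smul_measure ?_ _
  refine (ae_restrict_mem measurableSet_Icc).and (ae_restrict_of_ae ?_)
  have h1 : ∀ᵐ ω : ℝ, ω ≠ m := by simp [ae_iff]
  have h2 : ∀ᵐ ω : ℝ, ω ≠ -m := by simp [ae_iff]
  filter_upwards [h1, h2] with ω h3 h4 h5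
  exact (abs_eq_abs.1 h5).elim h3 h4

lemma ae_noiseLaw (ε : ℝ) : ∀ᵐ e ∂noiseLaw ε, |e| ≤ ε := by
  have : ∀ᵐ e ∂noiseLaw ε, e ∈ Icc (-ε) ε :=
    Measure.ae_smul_measure (ae_restrict_mem measurableSet_Icc) _
  filter_upwards [this] with e he
  exact abs_le.2 he

lemma ae_prod_laws (hε : 0 < ε) (m : ℝ) : ∀ᵐ p ∂stateLaw.prod (noiseLaw ε),
    (p.1 ∈ Icc (-1 : ℝ) 1 ∧ |p.1| ≠ |m|) ∧ |p.2| ≤ ε := by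
  have := isProbabilityMeasure_stateLaw
  have := isProbabilityMeasure_noiseLaw hε
  exact (Measure.quasiMeasurePreserving_fst.ae (ae_stateLaw m)).and
    (Measure.quasiMeasurePreserving_snd.ae (ae_noiseLaw ε))

/-- The expert is consistent and there is no tie, so `τ` is never consulted and the quack's position
as speaker does not matter. -/
lemma minRule_eq_quackSelection (τ : ℝ → ℝ → ℝ → ℝ) {p : ℝ × ℝ} (hne : |p.1| ≠ |m|)
    (hp : |p.2| ≤ ε) : minRule ε φ τ m p.1 (p.1 + p.2) = quackSelection ε φ m p ∧
      1 - minRule ε φ τ p.1 m (p.1 + p.2) = quackSelection ε φ m p := by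
  have hc : Consistent ε p.1 (p.1 + p.2) := by simpa [Consistent] using hp
  by_cases h1 : Consistent ε m (p.1 + p.2)
  · rcases lt_or_gt_of_ne hne with h2 | h2
    · simp [minRule, quackSelection, quackShare, hc, h1, h2, h2.not_gt, min_eq_left h2.le,
        min_eq_right h2.le]
    · simp [minRule, quackSelection, quackShare, hc, h1, h2, h2.not_gt, min_eq_left h2.le,
        min_eq_right h2.le]
  · simp [minRule, quackSelection, hc, h1]

lemma measurable_quackShare (hφ : Measurable φ) (m : ℝ) : Measurable (quackShare φ m) := by
  unfold quackShare
  refine Measurable.ite (measurableSet_lt measurable_const (by fun_prop)) (by fun_prop) ?_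
  exact measurable_const.sub (hφ.comp (by fun_prop))

lemma quackShare_mem (hφ : IsMinFunction φ) (hm : |m| ≤ 1) {ω : ℝ} (hω : |ω| ≤ 1) :
    quackShare φ m ω ∈ Icc (0 : ℝ) 1 := by
  have h1 := hφ.2 |m| ⟨abs_nonneg _, hm⟩
  have h2 := hφ.2 |ω| ⟨abs_nonneg _, hω⟩
  unfold quackShare
  split_ifs
  · exact h1
  · exact ⟨by linarith [h2.2], by linarith [h2.1]⟩

/-- Consistency confines the noise to an interval of half-width `ε` about `m - ω`; its overlap with
`[-ε, ε]` has length `tent (2 * ε) (m - ω)`. -/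
lemma integral_quackSelection_noise (hε : 0 < ε) (ω : ℝ) :
    ∫ e, quackSelection ε φ m (ω, e) ∂noiseLaw ε =
      quackShare φ m ω * (1 / (2 * ε) * tent (2 * ε) (m - ω)) := by
  have h1 : (fun e => quackSelection ε φ m (ω, e)) =
      (Icc (m - ω - ε) (m - ω + ε)).indicator fun _ => quackShare φ m ω := by
    ext e
    have : Consistent ε m (ω + e) ↔ e ∈ Icc (m - ω - ε) (m - ω + ε) := by
      rw [Consistent, abs_le, mem_Icc]
      constructor <;> rintro ⟨h2, h3⟩ <;> constructor <;> linarith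
    simp only [quackSelection, indicator, this]
  rw [h1, noiseLaw_eq hε, integral_smul_measure, integral_indicator measurableSet_Icc,
    Measure.restrict_restrict measurableSet_Icc, Icc_inter_Icc, setIntegral_const, measureReal_def,
    Real.volume_Icc, ENNReal.toReal_ofReal (by positivity), smul_eq_mul, smul_eq_mul]
  have h2 : (ENNReal.ofReal ((m - ω + ε) ⊓ ε - (m - ω - ε) ⊔ -ε)).toReal = tent (2 * ε) (m - ω) := by
    rw [ENNReal.toReal_ofReal', tent, max_comm]
    congr 1
    rcases abs_cases (m - ω) with ⟨h, h'⟩ | ⟨h, h'⟩ <;> rw [h]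
    · rw [inf_eq_right.2 (by linarith), sup_eq_left.2 (by linarith)]; ring
    · rw [inf_eq_left.2 (by linarith), sup_eq_right.2 (by linarith)]; ring
  rw [h2]; ring

lemma integrable_quackSelection (hε : 0 < ε) (hφ : IsMinFunction φ) (hm : |m| ≤ 1) :
    Integrable (quackSelection ε φ m) (stateLaw.prod (noiseLaw ε)) := by
  have := isProbabilityMeasure_stateLaw
  have := isProbabilityMeasure_noiseLaw hε
  have hmeas : Measurable (quackSelection ε φ m) := by
    unfold quackSelection Consistent
    exact Measurable.ite (measurableSet_le (by fun_prop) measurable_const)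
      ((measurable_quackShare hφ.1 m).comp measurable_fst) measurable_const
  refine Integrable.of_bound hmeas.aestronglyMeasurable 1 ?_
  filter_upwards [ae_prod_laws hε m] with p hp
  have h1 := quackShare_mem hφ hm (abs_le.2 hp.1.1)
  unfold quackSelection
  split_ifs
  · rw [Real.norm_eq_abs, abs_of_nonneg h1.1]; exact h1.2
  · simp

/-- After folding, split at `|m|`: above it the quack is the moderate speaker and has share `φ |m|`;
below it the expert is, and the quack's share is `1 - φ ω`. -/
lemma integral_quackShare (hφ : IsMinFunction φ) {δ : ℝ} (hm : |m| ≤ 1) :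
    ∫ ω in (-1 : ℝ)..1, quackShare φ m ω * tent δ (m - ω) = payoffCurve δ φ |m| := by
  have hsh : ∀ a b : ℝ, a ∈ Icc (-1 : ℝ) 1 → b ∈ Icc (-1 : ℝ) 1 →
      IntervalIntegrable (quackShare φ m) volume a b := by
    intro a b ha hb
    rw [intervalIntegrable_iff]
    refine Measure.integrableOn_of_bounded (M := 1) (by simp)
      (measurable_quackShare hφ.1 m).aestronglyMeasurable ?_
    filter_upwards [ae_restrict_mem measurableSet_uIoc] with ω hω
    have h1 := ordConnected_Icc.uIcc_subset ha hb (uIoc_subset_uIcc hω)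
    have h2 := quackShare_mem hφ hm (abs_le.2 h1)
    rw [Real.norm_eq_abs, abs_of_nonneg h2.1]; exact h2.2
  have htc : Continuous fun ω => tent δ (m - ω) := by fun_prop
  have hi : ∀ a b : ℝ, a ∈ Icc (-1 : ℝ) 1 → b ∈ Icc (-1 : ℝ) 1 →
      IntervalIntegrable (fun ω => quackShare φ m ω * tent δ (m - ω)) volume a b := fun a b ha hb =>
    (hsh a b ha hb).mul_continuousOn htc.continuousOn
  have hK : ∀ ω, foldKernel δ ω m = foldKernel δ ω |m| := by
    intro ω
    rcases abs_choice m with h | h <;> rw [h]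
    simp only [foldKernel]
    rw [← tent_neg δ (-m - ω), ← tent_neg δ (-m + ω)]
    ring_nf
  have h1 : ∫ ω in (-1 : ℝ)..1, quackShare φ m ω * tent δ (m - ω) =
      ∫ ω in (0 : ℝ)..1, quackShare φ m ω * foldKernel δ ω |m| := by
    rw [integral_fold (hi _ _ (by norm_num) (by norm_num)) (hi _ _ (by norm_num) (by norm_num))]
    refine intervalIntegral.integral_congr fun ω _ => ?_
    rw [← hK]
    simp only [foldKernel, quackShare, abs_neg, sub_neg_eq_add]
    ring
  have hmm : |m| ∈ Icc (-1 : ℝ) 1 := ⟨by linarith [abs_nonneg m], hm⟩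
  have hi' : ∀ a b : ℝ, a ∈ Icc (-1 : ℝ) 1 → b ∈ Icc (-1 : ℝ) 1 →
      IntervalIntegrable (fun ω => quackShare φ m ω * foldKernel δ ω |m|) volume a b :=
    fun a b ha hb => (hsh a b ha hb).mul_continuousOn (continuous_foldKernel_left δ _).continuousOn
  rw [h1, ← intervalIntegral.integral_add_adjacent_intervals (hi' 0 |m| (by norm_num) hmm)
    (hi' |m| 1 hmm (by norm_num))]
  have h2 : ∫ ω in (0 : ℝ)..|m|, quackShare φ m ω * foldKernel δ ω |m| =
      ∫ ω in (0 : ℝ)..|m|, (foldKernel δ ω |m| - φ ω * foldKernel δ ω |m|) := by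
    refine intervalIntegral.integral_congr fun ω hω => ?_
    rw [uIcc_of_le (abs_nonneg m)] at hω
    simp only [quackShare, abs_of_nonneg hω.1, if_neg (not_lt.2 hω.2)]
    ring
  have h3 : ∫ ω in |m|..1, quackShare φ m ω * foldKernel δ ω |m| = φ |m| * upperMass δ |m| := by
    rw [← integral_foldKernel_upper, ← intervalIntegral.integral_const_mul]
    refine intervalIntegral.integral_congr_ae (ae_of_all _ fun ω hω => ?_)
    rw [uIoc_of_le hm] at hω
    rw [quackShare, abs_of_pos ((abs_nonneg m).trans_lt hω.1), if_pos hω.1, foldKernel_comm]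
  have h4 : IntervalIntegrable (fun ω => φ ω * foldKernel δ ω |m|) volume 0 |m| := by
    refine IntervalIntegrable.mul_continuousOn ?_ (continuous_foldKernel_left δ _).continuousOn
    rw [intervalIntegrable_iff_integrableOn_Ioc_of_le (abs_nonneg m)]
    refine Measure.integrableOn_of_bounded (M := 1) (by simp) hφ.1.aestronglyMeasurable ?_
    filter_upwards [ae_restrict_mem measurableSet_Ioc] with ω hω
    have h5 := hφ.2 ω ⟨hω.1.le, hω.2.trans hm⟩
    rw [Real.norm_eq_abs, abs_of_nonneg h5.1]; exact h5.2
  rw [h2, h3, intervalIntegral.integral_sub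
    ((continuous_foldKernel_left δ _).intervalIntegrable _ _) h4, integral_foldKernel_lower,
    payoffCurve]
  ring

lemma integral_quackSelection (hε : 0 < ε) (hφ : IsMinFunction φ) (hm : |m| ≤ 1) :
    ∫ p, quackSelection ε φ m p ∂(stateLaw.prod (noiseLaw ε)) =
      1 / (4 * ε) * payoffCurve (2 * ε) φ |m| := by
  have := isProbabilityMeasure_stateLaw
  have := isProbabilityMeasure_noiseLaw hε
  rw [integral_prod _ (integrable_quackSelection hε hφ hm)]
  simp_rw [integral_quackSelection_noise hε]
  rw [stateLaw_eq, integral_smul_measure, integral_Icc_eq_integral_Ioc,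
    ← intervalIntegral.integral_of_le (by norm_num), ← integral_quackShare hφ hm,
    ENNReal.toReal_ofReal (by norm_num), smul_eq_mul, ← intervalIntegral.integral_const_mul,
    ← intervalIntegral.integral_const_mul]
  refine intervalIntegral.integral_congr fun ω _ => ?_
  field_simp
  ring

lemma quackPayoff_minRule (hε : 0 < ε) (hφ : IsMinFunction φ) (τ : ℝ → ℝ → ℝ → ℝ) (hm : |m| ≤ 1) :
    quackPayoffAsOne ε (minRule ε φ τ) m = 1 / (4 * ε) * payoffCurve (2 * ε) φ |m| ∧
      quackPayoffAsTwo ε (minRule ε φ τ) m = 1 / (4 * ε) * payoffCurve (2 * ε) φ |m| := by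
  rw [← integral_quackSelection hε hφ hm]
  constructor <;> refine integral_congr_ae ?_ <;>
    filter_upwards [ae_prod_laws hε m] with p hp
  · exact (minRule_eq_quackSelection τ hp.1.2 hp.2).1
  · exact (minRule_eq_quackSelection τ hp.1.2 hp.2).2

lemma quackIndifferent_minRule_iff (hε : 0 < ε) (hφ : IsMinFunction φ) (τ : ℝ → ℝ → ℝ → ℝ) :
    QuackIndifferent ε (minRule ε φ τ) ↔
      ∀ x ∈ Icc (0 : ℝ) 1, payoffCurve (2 * ε) φ x = payoffCurve (2 * ε) φ 0 := by
  constructor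
  · intro h x hx
    have h1 := (h x ⟨by linarith [hx.1], hx.2⟩ 0 (by norm_num)).1
    rw [(quackPayoff_minRule hε hφ τ (abs_le.2 ⟨by linarith [hx.1], hx.2⟩)).1,
      (quackPayoff_minRule hε hφ τ (by simp)).1, abs_of_nonneg hx.1, abs_zero] at h1
    exact mul_left_cancel₀ (by positivity) h1
  · intro h m hm m' hm'
    have h1 := quackPayoff_minRule hε hφ τ (abs_le.2 hm)
    have h2 := quackPayoff_minRule hε hφ τ (abs_le.2 hm')
    rw [h1.1, h1.2, h2.1, h2.2, h |m| ⟨abs_nonneg m, abs_le.2 hm⟩,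
      h |m'| ⟨abs_nonneg m', abs_le.2 hm'⟩]
    exact ⟨rfl, rfl⟩

end Payoff

/-! ### Uniqueness. -/

lemma IsMinFunction.intervalIntegrable {φ : ℝ → ℝ} (hφ : IsMinFunction φ) {b : ℝ} (hb0 : 0 ≤ b)
    (hb : b ≤ 1) : IntervalIntegrable φ volume 0 b := by
  rw [intervalIntegrable_iff_integrableOn_Ioc_of_le hb0]
  refine Measure.integrableOn_of_bounded (M := 1) (by simp) hφ.1.aestronglyMeasurable ?_
  filter_upwards [ae_restrict_mem measurableSet_Ioc] with ω hω
  have h := hφ.2 ω ⟨hω.1.le, hω.2.trans hb⟩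
  rw [Real.norm_eq_abs, abs_of_nonneg h.1]; exact h.2

/-- A constant payoff curve takes the value `payoffLevel`. -/
lemma payoffCurve_eq_payoffLevel {δ c : ℝ} (hδ : 0 < δ) (hδ2 : δ < 2) {φ : ℝ → ℝ}
    (hφ : IsMinFunction φ) (hc : ∀ x ∈ Icc (0 : ℝ) 1, payoffCurve δ φ x = c) :
    c = payoffLevel δ := by
  have h1 := integral_payoff_identity hδ zero_le_one (hφ.intervalIntegrable zero_le_one le_rfl)
  simp only [intervalIntegral.integral_same, mul_zero, intervalIntegral.integral_zero] at h1
  have h2 : ∫ m in (0 : ℝ)..1, (φ m * upperMass δ m - ∫ x in (0 : ℝ)..m, φ x * foldKernel δ x m) =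
      ∫ m in (0 : ℝ)..1, (c - tentInt δ (2 * m)) := by
    refine intervalIntegral.integral_congr fun m hm => ?_
    rw [uIcc_of_le zero_le_one] at hm
    rw [← hc m hm, payoffCurve]; ring
  rw [h2, intervalIntegral.integral_sub (by simp) (Continuous.intervalIntegrable (by fun_prop) _ _),
    integral_tentInt_two_mul hδ hδ2, intervalIntegral.integral_const, smul_eq_mul] at h1
  linarith

/-- Iterating the inequality from the bound `B` gives `B * (M * x) ^ n / n!`, which tends to zero.
No continuity of `d` is required. -/
lemma eq_zero_of_abs_le_integral {d : ℝ → ℝ} {b B M : ℝ} (hM : 0 ≤ M)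
    (hd : IntervalIntegrable d volume 0 b) (hB : ∀ x ∈ Icc 0 b, |d x| ≤ B)
    (h : ∀ x ∈ Icc 0 b, |d x| ≤ M * ∫ y in (0 : ℝ)..x, |d y|) : ∀ x ∈ Icc 0 b, d x = 0 := by
  have hpow : ∀ n : ℕ, ∀ x ∈ Icc 0 b, |d x| ≤ B * ((M * x) ^ n / n.factorial) := by
    intro n
    induction n with
    | zero => intro x hx; simpa using hB x hx
    | succ n ih =>
      intro x hx
      refine (h x hx).trans ?_
      have hi : IntervalIntegrable (fun y => |d y|) volume 0 x :=
        (hd.mono_set (by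
          rw [uIcc_of_le hx.1, uIcc_of_le (hx.1.trans hx.2)]
          exact Icc_subset_Icc_right hx.2)).abs
      have h1 : ∫ y in (0 : ℝ)..x, |d y| ≤
          ∫ y in (0 : ℝ)..x, B * M ^ n / n.factorial * y ^ n := by
        refine intervalIntegral.integral_mono_on hx.1 hi
          (Continuous.intervalIntegrable (by fun_prop) _ _) fun y hy => ?_
        refine (ih y ⟨hy.1, hy.2.trans hx.2⟩).trans_eq ?_
        rw [mul_pow]; ring
      refine (mul_le_mul_of_nonneg_left h1 hM).trans_eq ?_
      rw [intervalIntegral.integral_const_mul, integral_pow, Nat.factorial_succ]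
      have h2 : (n.factorial : ℝ) ≠ 0 := by positivity
      have h3 : (n : ℝ) + 1 ≠ 0 := by positivity
      push_cast
      field_simp
      ring
  intro x hx
  have hlim := (FloorSemiring.tendsto_pow_div_factorial_atTop (M * x)).const_mul B
  rw [mul_zero] at hlim
  exact abs_nonpos_iff.1 (ge_of_tendsto' hlim fun n => hpow n x hx)

/-- Two min functions with the same constant payoff curve agree on `[0, 1)`. -/
lemma eqOn_of_payoffCurve_eq {δ : ℝ} (hδ : 0 < δ) (hδ2 : δ < 2) {φ ψ : ℝ → ℝ}
    (hφ : IsMinFunction φ) (hψ : IsMinFunction ψ)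
    (h : ∀ x ∈ Icc (0 : ℝ) 1, payoffCurve δ φ x = payoffCurve δ ψ x) : EqOn φ ψ (Ico 0 1) := by
  intro b hb
  have hb1 : 0 < 1 - b := sub_pos.2 hb.2
  have hi : ∀ x ∈ Icc 0 b, IntervalIntegrable (fun y => φ y - ψ y) volume 0 x := fun x hx =>
    (hφ.intervalIntegrable hx.1 (hx.2.trans hb.2.le)).sub
      (hψ.intervalIntegrable hx.1 (hx.2.trans hb.2.le))
  -- A uniform lower bound for `upperMass` on `[0, b]`; it degenerates as `b → 1`, hence the work on
  -- each `b < 1` separately.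
  set κ := δ ^ 2 / 4 * (1 - b) with hκ
  have hκ0 : 0 < κ := by positivity
  refine sub_eq_zero.1 (eq_zero_of_abs_le_integral (d := fun y => φ y - ψ y) (b := b) (B := 1)
    (M := 2 * δ / κ) (by positivity) (hi b ⟨hb.1, le_rfl⟩) (fun x hx => ?_) (fun x hx => ?_) b
    ⟨hb.1, le_rfl⟩)
  · have hx1 : x ∈ Icc (0 : ℝ) 1 := ⟨hx.1, hx.2.trans hb.2.le⟩
    have h1 := hφ.2 x hx1
    have h2 := hψ.2 x hx1
    exact abs_le.2 ⟨by linarith [h1.1, h2.2], by linarith [h1.2, h2.1]⟩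
  · have hx1 : x ∈ Icc (0 : ℝ) 1 := ⟨hx.1, hx.2.trans hb.2.le⟩
    have h1 := h x hx1
    have hK := (continuous_foldKernel_left δ x).continuousOn (s := uIcc 0 x)
    have h2 : (φ x - ψ x) * upperMass δ x =
        ∫ y in (0 : ℝ)..x, (φ y - ψ y) * foldKernel δ y x := by
      simp_rw [sub_mul]
      rw [intervalIntegral.integral_sub
        ((hφ.intervalIntegrable hx1.1 hx1.2).mul_continuousOn hK)
        ((hψ.intervalIntegrable hx1.1 hx1.2).mul_continuousOn hK)]
      unfold payoffCurve at h1
      linarith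
    have hA : κ ≤ upperMass δ x := by
      refine le_trans ?_ (upperMass_ge hδ hδ2 hx1.1 hx1.2)
      rw [hκ]
      exact mul_le_mul_of_nonneg_left (by linarith [hx.2]) (by positivity)
    have h3 : |∫ y in (0 : ℝ)..x, (φ y - ψ y) * foldKernel δ y x| ≤
        ∫ y in (0 : ℝ)..x, |φ y - ψ y| * (2 * δ) := by
      rw [← Real.norm_eq_abs]
      refine intervalIntegral.norm_integral_le_of_norm_le hx.1 (ae_of_all _ fun y _ => ?_)
        ((hi x hx).abs.mul_const _)
      rw [Real.norm_eq_abs, abs_mul]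
      exact mul_le_mul_of_nonneg_left (abs_foldKernel_le hδ y x) (abs_nonneg _)
    rw [← h2, abs_mul, abs_of_pos (hκ0.trans_le hA), intervalIntegral.integral_mul_const] at h3
    rw [div_mul_eq_mul_div, le_div_iff₀ hκ0]
    have := mul_le_mul_of_nonneg_left hA (abs_nonneg (φ x - ψ x))
    linarith

/-! ### Extension to the endpoint and the theorem. -/

lemma continuous_payoffCurve (δ : ℝ) {φ : ℝ → ℝ} (hφ : Continuous φ) :
    Continuous (payoffCurve δ φ) := by
  have h1 : Continuous fun m => ∫ x in (0 : ℝ)..m, φ x * foldKernel δ x m := by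
    refine intervalIntegral.continuous_parametric_intervalIntegral_of_continuous
      (f := fun m x => φ x * foldKernel δ x m) ?_ continuous_id
    have h2 : Continuous fun p : ℝ × ℝ => foldKernel δ p.2 p.1 :=
      (continuous_foldKernel δ).comp (by fun_prop : Continuous fun p : ℝ × ℝ => (p.2, p.1))
    simp only [Function.uncurry_def]
    fun_prop
  unfold payoffCurve
  fun_prop

lemma exists_continuous_strictAnti_extension {φ : ℝ → ℝ} (hc : ContinuousOn φ (Ico 0 1))
    (ha : StrictAntiOn φ (Ico 0 1)) (hp : ∀ x ∈ Ico (0 : ℝ) 1, 0 < φ x) :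
    ∃ ψ : ℝ → ℝ, Continuous ψ ∧ EqOn ψ φ (Ico 0 1) ∧ StrictAntiOn ψ (Icc 0 1) ∧
      ∀ x ∈ Icc (0 : ℝ) 1, 0 ≤ ψ x := by
  have hbdd : BddBelow (φ '' Ioo 0 1) :=
    ⟨0, by rintro _ ⟨x, hx, rfl⟩; exact (hp x ⟨hx.1.le, hx.2⟩).le⟩
  have hlim := (ha.antitoneOn.mono Ioo_subset_Ico_self).tendsto_nhdsWithin_Ioo_left
    (nonempty_Ioo.2 zero_lt_one) hbdd
  set L := sInf (φ '' Ioo 0 1) with hL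
  have hL0 : 0 ≤ L := Real.sInf_nonneg (by rintro _ ⟨x, hx, rfl⟩; exact (hp x ⟨hx.1.le, hx.2⟩).le)
  have hLle : ∀ x ∈ Ioo (0 : ℝ) 1, L ≤ φ x := fun x hx => csInf_le hbdd ⟨x, hx, rfl⟩
  set θ : ℝ → ℝ := Function.update φ 1 L with hθ
  have hθ1 : θ 1 = L := Function.update_self ..
  have hθe : ∀ x, x < 1 → θ x = φ x := fun x hx => Function.update_of_ne hx.ne ..
  have hθc : ContinuousOn θ (Icc 0 1) := by
    rw [hθ, continuousOn_update_iff, Icc_sdiff_right]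
    exact ⟨hc, fun _ => hlim.mono_left (nhdsWithin_mono _ fun x hx => hx.2)⟩
  have hclamp : ∀ x ∈ Icc (0 : ℝ) 1, max 0 (min 1 x) = x := fun x hx => by
    rw [min_eq_right hx.2, max_eq_right hx.1]
  refine ⟨fun x => θ (max 0 (min 1 x)), ?_, fun x hx => ?_, fun x hx y hy hxy => ?_,
    fun x hx => ?_⟩
  · exact hθc.comp_continuous (by fun_prop) fun x =>
      ⟨le_max_left _ _, max_le zero_le_one (min_le_left _ _)⟩
  · simp only
    rw [hclamp x ⟨hx.1, hx.2.le⟩, hθe x hx.2]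
  · simp only
    rw [hclamp x hx, hclamp y hy, hθe x (hxy.trans_le hy.2)]
    rcases hy.2.eq_or_lt with rfl | hy1
    · rw [hθ1]
      -- The midpoint of `x` and `1` turns the weak bound `L ≤ φ` into a strict inequality at the
      -- endpoint.
      have h1 : (x + 1) / 2 ∈ Ioo (0 : ℝ) 1 := ⟨by linarith [hx.1], by linarith⟩
      exact (hLle _ h1).trans_lt (ha ⟨hx.1, hxy⟩ ⟨h1.1.le, h1.2⟩ (by linarith))
    · rw [hθe y hy1]
      exact ha ⟨hx.1, hxy.trans hy1⟩ ⟨hy.1, hy1⟩ hxy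
  · simp only
    rw [hclamp x hx]
    rcases hx.2.eq_or_lt with rfl | hx1
    · rwa [hθ1]
    · rw [hθe x hx1]; exact (hp x ⟨hx.1, hx1⟩).le

theorem lemma2 (ε : ℝ) (hε : ε ∈ Set.Ioo (0 : ℝ) 1) :
    ∃ φ : ℝ → ℝ,
      IsMinFunction φ ∧
      ContinuousOn φ (Set.Icc 0 1) ∧
      (∀ τ : ℝ → ℝ → ℝ → ℝ, IsSelectionRule τ → QuackIndifferent ε (minRule ε φ τ)) ∧
      (∀ φ' : ℝ → ℝ, IsMinFunction φ' →
        ∀ τ : ℝ → ℝ → ℝ → ℝ, IsSelectionRule τ →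
          QuackIndifferent ε (minRule ε φ' τ) → Set.EqOn φ' φ (Set.Ico 0 1)) ∧
      StrictAntiOn φ (Set.Icc 0 1) ∧
      φ 0 < 1 / 2 ∧
      (ε ≤ 1 / 2 → φ 0 = 1 / 2 - ε / 6) := by
  have hδ : 0 < 2 * ε := by linarith [hε.1]
  have hδ2 : 2 * ε < 2 := by linarith [hε.2]
  obtain ⟨φ₀, h⟩ := exists_isProfile hδ hδ2
  obtain ⟨φ, hc, heq, hanti, hpos⟩ := exists_continuous_strictAnti_extension
    (h.cont.mono IsProfile.Ico_subset_Ioo) (h.strictAntiOn hδ hδ2) (h.pos hδ hδ2)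
  have h00 : φ 0 = φ₀ 0 := heq (by simp)
  have hhalf : φ 0 < 1 / 2 := h00 ▸ h.apply_zero_lt hδ
  have hmin : IsMinFunction φ := ⟨hc.measurable, fun x hx => ⟨hpos x hx, by
    linarith [hanti.antitoneOn (left_mem_Icc.2 zero_le_one) hx hx.1]⟩⟩
  have hcurve : ∀ x ∈ Icc (0 : ℝ) 1, payoffCurve (2 * ε) φ x = payoffLevel (2 * ε) := by
    have h1 : EqOn (payoffCurve (2 * ε) φ) (fun _ => payoffLevel (2 * ε)) (Ico 0 1) := by
      intro x hx
      have h2 : ∫ y in (0 : ℝ)..x, φ y * foldKernel (2 * ε) y x =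
          ∫ y in (0 : ℝ)..x, φ₀ y * foldKernel (2 * ε) y x := by
        refine intervalIntegral.integral_congr fun y hy => ?_
        rw [uIcc_of_le hx.1] at hy
        rw [heq ⟨hy.1, hy.2.trans_lt hx.2⟩]
      simp only [payoffCurve]
      rw [h2, heq hx, h.eqn x hx]
      ring
    -- Message `1` lies outside the profile equation and is reached by continuity of the payoff
    -- curve.
    have h3 := h1.closure (continuous_payoffCurve _ hc) continuous_const
    rwa [closure_Ico zero_ne_one] at h3
  refine ⟨φ, hmin, hc.continuousOn, fun τ _ => ?_, fun φ' hφ' τ _ hind => ?_, hanti, hhalf,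
    fun hε2 => ?_⟩
  · rw [quackIndifferent_minRule_iff hε.1 hmin]
    intro x hx
    rw [hcurve x hx, hcurve 0 (by simp)]
  · rw [quackIndifferent_minRule_iff hε.1 hφ'] at hind
    have h1 := payoffCurve_eq_payoffLevel hδ hδ2 hφ' hind
    exact eqOn_of_payoffCurve_eq hδ hδ2 hφ' hmin fun x hx => by rw [hind x hx, h1, hcurve x hx]
  · have h1 := h.apply_zero_eq
    -- Since `2 * ε ≤ 1`, the tent lies within reach of `1` and `tentInt` has attained its full
    -- value.
    rw [tentInt_of_ge hδ (by linarith), payoffLevel] at h1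
    rw [h00]
    have h2 : (2 * ε) ^ 2 ≠ 0 := by positivity
    refine mul_right_cancel₀ h2 ?_
    linear_combination h1
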